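/- **Nonadaptive three-query PCP games.** Such a game $G=(Q,A,R,\pi)$ consists of a positive integer $Q$, a finite non-empty set $A$, a predicate $R:[Q]^3\times A^3\to\{0,1\}$ and a probability distribution $\pi$ on $\{(q_1,q_2,q_3): 1\le q_1<q_2<q_3\le Q\}$. Its value $w(G)$ is the maximum, over all probability distributions $\theta$ on $A^Q$, of $\sum_{q_1<q_2<q_3}\pi(q_1,q_2,q_3)\sum_{\Pi\in A^Q}\theta(\Pi)\,R(\Pi[q_1],\Pi[q_2],\Pi[q_3]\mid q_1,q_2,q_3)$. **Two-prover one-round games.** A verifier sends random questions $q_1\in Q_1$, $q_2\in Q_2$ to two provers, who answer $a_1\in A_1$, $a_2\in A_2$ (all four sets finite) and win if the verifier's predicate accepts; the predicate may depend on the questions, the answers and on private randomness $r$ that the verifier generated together with the questions. A strategy is a family $\theta(a_1,a_2\mid q_1,q_2)$ of probability distributions on $A_1\times A_2$. It is *unentangled* if each prover's answer is a function of the prover's own question, a shared classical random source and a private classical random source (the sources being independent). It is *commuting-operator* if $\theta(a_1,a_2\mid q_1,q_2)=\mathrm{tr}(\rho\, M_{q_1}^{a_1}N_{q_2}^{a_2})$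 for a (possibly mixed) state $\rho$ on a complex Hilbert space of arbitrary, possibly infinite, dimension and POVMs $\{M_{q_1}^{a_1}\}_{a_1\in A_1}$, $\{N_{q_2}^{a_2}\}_{a_2\in A_2}$ on it such that every $M_{q_1}^{a_1}$ commutes with every $N_{q_2}^{a_2}$. The values $w_{\mathrm{unent}}$ and $w_{\mathrm{com}}$ are the suprema of the winning probability over the strategies of the respective class. **Oracularization with a dummy question.** From $G$ one obtains a two-prover one-round game $G'$ with question sets $[Q]^3$, $[Q]^2$ and answer sets $A^3$, $A^2$ as follows. The verifier draws two independent triples $(q_1,q_2,q_3)$ and $(\tilde q_1,\tilde q_2,\tilde q_3)$ from $\pi$, and then $q\in\{q_1,q_2,q_3\}$ and $\tilde q\in\{\tilde q_1,\tilde q_2,\tilde q_3\}$ uniformly and independently. Let $r=1$ if $q<\tilde q$, $r=2$ if $q>\tilde q$, and let $r\in\{1,2\}$ be uniformly random if $q=\tilde q$. The first prover is sent $(q_1,q_2,q_3)$; the second prover is sent $(q,\tilde q)$ if $r=1$ and $(\tilde q,q)$ if $r=2$. On answers $(a_1,a_2,a_3)\in A^3$ and $(a_1',a_2')\in A^2$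 the provers win if and only if $R(a_1,a_2,a_3\mid q_1,q_2,q_3)=1$ and $a_r'=a_j$ for the $j$ with $q=q_j$. **Lemma 4.1.** There exists an absolute constant $c>0$ such that for every nonadaptive three-query PCP game $G=(Q,A,R,\pi)$, with $G'$ its oracularization with a dummy question, $$w(G)\le w_{\mathrm{unent}}(G')\le 1-\frac{1-w(G)}{3},\qquad w_{\mathrm{com}}(G')\le 1-\frac{c\,(1-w(G))^2}{Q^2}.$$ -/

import Mathlib

universe u v w u₁ u₂ u₃ u₄ u₅

/-- A nonadaptive three-query PCP game with `Q` positions and alphabet `A`: a probability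
distribution `π` over triples `q 0 < q 1 < q 2` of positions, and a predicate `R q a` saying that
the verifier accepts when the letters read at the positions `q` are `a`. -/
structure PCPGame (Q : ℕ) (A : Type u) where
  π : (Fin 3 → Fin Q) → ℝ
  π_mem : π ∈ stdSimplex ℝ (Fin 3 → Fin Q)
  π_support : ∀ q, ¬ StrictMono q → π q = 0
  R : (Fin 3 → Fin Q) → (Fin 3 → A) → Prop

/-- A two-prover one-round game with question sets `Q₁`, `Q₂` and answer sets `A₁`, `A₂`.
The verifier draws `(q₁, q₂, s)` from `π`, sends `q₁` and `q₂` to the two provers, and keeps `s`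
for itself; the provers win with the answers `a₁`, `a₂` iff `R q₁ q₂ s a₁ a₂`. When `S` is a point
the predicate is a function of the questions and the answers alone. -/
structure TwoProverGame (Q₁ : Type u₁) (Q₂ : Type u₂) (S : Type u₃) (A₁ : Type u₄) (A₂ : Type u₅)
    [Fintype Q₁] [Fintype Q₂] [Fintype S] where
  π : Q₁ × Q₂ × S → ℝ
  π_mem : π ∈ stdSimplex ℝ (Q₁ × Q₂ × S)
  R : Q₁ → Q₂ → S → A₁ → A₂ → Prop

namespace PCPGame

variable {Q : ℕ} {A : Type u} [Fintype A]

open Classical in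
/-- The winning probability when the prover sends the string `x` with probability `θ x`. -/
noncomputable def winProb (G : PCPGame Q A) (θ : (Fin Q → A) → ℝ) : ℝ :=
  ∑ q, G.π q * ∑ x, θ x * (if G.R q (fun i => x (q i)) then 1 else 0)

/-- The value `w(G)`: the optimal winning probability over all probability distributions on the
strings of length `Q`. -/
noncomputable def value (G : PCPGame Q A) : ℝ :=
  sSup (G.winProb '' stdSimplex ℝ (Fin Q → A))

end PCPGame

section Strategies

variable {Q₁ : Type u₁} {Q₂ : Type u₂} {A₁ : Type u₄} {A₂ : Type u₅}

/-- `θ q₁ q₂ a₁ a₂` is the probability of the answers `(a₁, a₂)` to the questions `(q₁, q₂)` for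
two provers that share a classical random source `Ω`, that have private random sources `Ω₁`, `Ω₂`
(all three independent), and whose answers are arbitrary functions of the own question, the shared
source and the own private source. -/
def IsUnentangled (θ : Q₁ → Q₂ → A₁ → A₂ → ℝ) : Prop :=
  ∃ (Ω Ω₁ Ω₂ : Type w) (_ : MeasurableSpace Ω) (_ : MeasurableSpace Ω₁) (_ : MeasurableSpace Ω₂)
    (μ : MeasureTheory.Measure Ω) (μ₁ : MeasureTheory.Measure Ω₁)
    (μ₂ : MeasureTheory.Measure Ω₂)
    (f₁ : Q₁ → Ω × Ω₁ → A₁) (f₂ : Q₂ → Ω × Ω₂ → A₂),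
    MeasureTheory.IsProbabilityMeasure μ ∧ MeasureTheory.IsProbabilityMeasure μ₁ ∧
    MeasureTheory.IsProbabilityMeasure μ₂ ∧
    (∀ q₁ a₁, MeasurableSet (f₁ q₁ ⁻¹' {a₁})) ∧
    (∀ q₂ a₂, MeasurableSet (f₂ q₂ ⁻¹' {a₂})) ∧
    ∀ q₁ q₂ a₁ a₂, θ q₁ q₂ a₁ a₂ =
      (μ.prod (μ₁.prod μ₂)).real
        {ω | f₁ q₁ (ω.1, ω.2.1) = a₁ ∧ f₂ q₂ (ω.1, ω.2.2) = a₂}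

/-- A positive operator-valued measure with a finite set `A` of outcomes. -/
def IsPOVM {A : Type u} [Fintype A] {H : Type v} [NormedAddCommGroup H] [InnerProductSpace ℂ H]
    (E : A → H →L[ℂ] H) : Prop :=
  (∀ a, (E a).IsPositive) ∧ ∑ a, E a = 1

/-- `θ q₁ q₂ a₁ a₂` is the probability of the answers `(a₁, a₂)` to the questions `(q₁, q₂)` for
two provers that share a quantum state in a complex Hilbert space `H` of arbitrary dimension and
answer with the outcomes of POVMs on `H`, those of the first prover commuting with those of the
second. The state may be mixed: it is the density operator `ρ = ∑ k, |ψ k⟩⟨ψ k|` of trace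
`∑ k, ‖ψ k‖ ^ 2 = 1` (every density operator has this form; a pure state has one nonzero term), and
the probability of the answers is
`tr (ρ M N) = ∑ k, ⟨ψ k, M N ψ k⟩`. -/
def IsCommutingOperator [Fintype A₁] [Fintype A₂] (θ : Q₁ → Q₂ → A₁ → A₂ → ℝ) : Prop :=
  ∃ (H : Type v) (_ : NormedAddCommGroup H) (_ : InnerProductSpace ℂ H) (_ : CompleteSpace H)
    (ψ : ℕ → H) (M : Q₁ → A₁ → H →L[ℂ] H) (N : Q₂ → A₂ → H →L[ℂ] H),
    HasSum (fun k => ‖ψ k‖ ^ 2) 1 ∧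
    (∀ q₁, IsPOVM (M q₁)) ∧ (∀ q₂, IsPOVM (N q₂)) ∧
    (∀ q₁ q₂ a₁ a₂, Commute (M q₁ a₁) (N q₂ a₂)) ∧
    ∀ q₁ q₂ a₁ a₂,
      HasSum (fun k => inner ℂ (ψ k) (M q₁ a₁ (N q₂ a₂ (ψ k)))) ((θ q₁ q₂ a₁ a₂ : ℝ) : ℂ)

end Strategies

namespace TwoProverGame

variable {Q₁ : Type u₁} {Q₂ : Type u₂} {S : Type u₃} {A₁ : Type u₄} {A₂ : Type u₅}
  [Fintype Q₁] [Fintype Q₂] [Fintype S] [Fintype A₁] [Fintype A₂]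

open Classical in
/-- The winning probability of the strategy `θ`. -/
noncomputable def winProb (G : TwoProverGame Q₁ Q₂ S A₁ A₂) (θ : Q₁ → Q₂ → A₁ → A₂ → ℝ) : ℝ :=
  ∑ q₁, ∑ q₂, ∑ s, G.π (q₁, q₂, s) *
    ∑ a₁, ∑ a₂, θ q₁ q₂ a₁ a₂ * (if G.R q₁ q₂ s a₁ a₂ then 1 else 0)

/-- The unentangled value; the random sources range over all probability spaces in `Type w`. -/
noncomputable def unentValue (G : TwoProverGame Q₁ Q₂ S A₁ A₂) : ℝ :=
  sSup (G.winProb '' {θ | IsUnentangled.{w} θ})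

/-- The commuting-operator value; the Hilbert space ranges over all those in `Type v`. -/
noncomputable def comValue (G : TwoProverGame Q₁ Q₂ S A₁ A₂) : ℝ :=
  sSup (G.winProb '' {θ | IsCommutingOperator.{v} θ})

end TwoProverGame

namespace PCPGame

variable {Q : ℕ} {A : Type u}

/-- The probability that the real question `q` is put in place `r` of the pair sent to the second
prover, when the dummy question is `d`: the smaller position comes first, and a tie is broken by a
fair coin. The places are numbered `0` and `1`. -/
noncomputable def placeProb (q d : Fin Q) (r : Fin 2) : ℝ :=
  if q < d then (if r = 0 then 1 else 0)
  else if d < q then (if r = 1 then 1 else 0)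
  else 1 / 2

/-- The pair with the real question `q` in place `r` and the dummy question `d` in the other. -/
def secondQuestion (q d : Fin Q) (r : Fin 2) : Fin 2 → Fin Q :=
  if r = 0 then ![q, d] else ![d, q]

/-- The distribution of `(t, p, r)`, where `t` and `t'` are independent triples drawn from `π`,
the real question `t j` and the dummy question `t' k` are chosen uniformly and independently from
`t` and `t'`, `r` is the place of the real question, and `p` is the pair sent to the second
prover. -/
noncomputable def dummyDist (G : PCPGame Q A)
    (ω : (Fin 3 → Fin Q) × (Fin 2 → Fin Q) × Fin 2) : ℝ :=
  ∑ t', ∑ j : Fin 3, ∑ k : Fin 3,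
    if ω.2.1 = secondQuestion (ω.1 j) (t' k) ω.2.2 then
      G.π ω.1 * G.π t' * (1 / 3) * (1 / 3) * placeProb (ω.1 j) (t' k) ω.2.2
    else 0

theorem placeProb_nonneg (q d : Fin Q) (r : Fin 2) : 0 ≤ placeProb q d r := by
  unfold placeProb
  split_ifs <;> norm_num

theorem sum_placeProb (q d : Fin Q) : ∑ r, placeProb q d r = 1 := by
  rw [Fin.sum_univ_two]
  unfold placeProb
  split_ifs <;> simp_all; norm_num

theorem dummyDist_mem (G : PCPGame Q A) :
    G.dummyDist ∈ stdSimplex ℝ ((Fin 3 → Fin Q) × (Fin 2 → Fin Q) × Fin 2) := by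
  refine ⟨fun ω => ?_, ?_⟩
  · refine Finset.sum_nonneg fun t' _ => Finset.sum_nonneg fun j _ =>
      Finset.sum_nonneg fun k _ => ?_
    split_ifs
    · have h1 := G.π_mem.1 ω.1
      have h2 := G.π_mem.1 t'
      have h3 := placeProb_nonneg (ω.1 j) (t' k) ω.2.2
      positivity
    · exact le_rfl
  · have key : ∀ t : Fin 3 → Fin Q,
        (∑ p : Fin 2 → Fin Q, ∑ r : Fin 2, G.dummyDist (t, p, r)) = G.π t := by
      intro t
      have h : ∀ (t' : Fin 3 → Fin Q) (j k : Fin 3),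
          (∑ r : Fin 2, ∑ p : Fin 2 → Fin Q,
            if p = secondQuestion (t j) (t' k) r then
              G.π t * G.π t' * (1 / 3) * (1 / 3) * placeProb (t j) (t' k) r else 0)
            = G.π t * G.π t' * (1 / 3) * (1 / 3) := by
        intro t' j k
        simp only [Finset.sum_ite_eq', Finset.mem_univ, if_true]
        rw [← Finset.mul_sum, sum_placeProb, mul_one]
      calc (∑ p : Fin 2 → Fin Q, ∑ r : Fin 2, G.dummyDist (t, p, r))
          = ∑ t', ∑ j : Fin 3, ∑ k : Fin 3, ∑ r : Fin 2, ∑ p : Fin 2 → Fin Q,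
            (if p = secondQuestion (t j) (t' k) r then
              G.π t * G.π t' * (1 / 3) * (1 / 3) * placeProb (t j) (t' k) r else 0) := by
            rw [Finset.sum_comm]
            unfold dummyDist
            simp only [Finset.sum_comm (γ := Fin 2 → Fin Q)]
            simp only [Finset.sum_comm (s := (Finset.univ : Finset (Fin 2)))]
        _ = ∑ t', G.π t * G.π t' := by
            simp only [h, Finset.sum_const, Finset.card_univ, Fintype.card_fin, nsmul_eq_mul]
            refine Finset.sum_congr rfl fun t' _ => ?_
            push_cast
            ring
        _ = G.π t := by rw [← Finset.mul_sum, G.π_mem.2, mul_one]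
    rw [Fintype.sum_prod_type]
    simp only [Fintype.sum_prod_type, key]
    exact G.π_mem.2

/-- Oracularization with a dummy question. The verifier sends the triple `t` to the first prover
and the pair `p` to the second, and remembers the place `r` of the real question `p r` in `p`.
The provers win iff the answers `a` of the first prover satisfy the predicate of `G` and the
second prover's answer `b r` to the real question equals the first prover's answer to it. -/
noncomputable def dummyOracularization (G : PCPGame Q A) :
    TwoProverGame (Fin 3 → Fin Q) (Fin 2 → Fin Q) (Fin 2) (Fin 3 → A) (Fin 2 → A) where
  π := G.dummyDist
  π_mem := G.dummyDist_mem
  R t p r a b := G.R t a ∧ ∀ j, p r = t j → b r = a j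

end PCPGame

/-! Unentangled bounds. If both provers answer from one fixed string, they always agree and win
exactly when the string is accepted; averaging over strings gives the lower bound. For the upper
bound, convexity leaves only deterministic strategies. Once the dummy question and the tie-breaking
coin are fixed, the second prover's answers to real questions form a string. On a triple where this
string is rejected, the first prover either gives rejected answers or disagrees with the string in
one of three places, so at least one choice of the real question loses (`winProb_deterministic_le`).

Commuting-operator bound. Let ε be the losing probability of a strategy on a pure state ψ. The
second prover's measurement for position q, averaged over the dummy question, is a POVM; its square
roots are Kraus operators K_q. Measuring all positions of ψ in sequence with the K_q produces a
random string, hence a strategy for `G`. The first prover's POVMs commute with every K_q, so the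
string can be compared with that prover's answers to a triple. It is accepted nearly as often, up to
the disagreement of the two provers and the disturbance of each position by the positions measured
earlier (`one_sub_accept_le`).

The disturbance is controlled by near-commutation on ψ. Agreement makes K_q ψ close to L_q ψ, where
L_q comes from a measurement of the first prover and commutes with all K's
(`famNorm_sqrt_sub_sqrt_sq_le`). For distinct q and d the sorted pair is the same question whichever
of the two is real, so one measurement answers both; consistency of L_q and L_d with it makes K_q
and K_d nearly commute (`famNorm_commutator_le`). Replacing K's by L's also keeps every error on ψ
itself instead of on a post-measurement state (`famNorm_seqOp_sub_skipOp_le`).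

Finally, positions are measured in order of decreasing probability μ. The weight of a later position
is then at most √(μ_q μ_d), and Cauchy–Schwarz over the pairs bounds the total disturbance by a
constant times Q√ε (`sum_mul_sum_lt_le`). Thus 1 - w(G) is at most a constant times Q√ε. -/

/-! ### The ℓ² norm of families of vectors. -/

section FamilyNorm

variable {ι κ : Type*} [Fintype ι] [Fintype κ] {H : Type*} [NormedAddCommGroup H]

/-- The `ℓ²` norm of a finite family of vectors. -/
noncomputable def famNorm (v : ι → H) : ℝ := √(∑ i, ‖v i‖ ^ 2)

theorem famNorm_nonneg (v : ι → H) : 0 ≤ famNorm v := Real.sqrt_nonneg _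

theorem famNorm_sq (v : ι → H) : famNorm v ^ 2 = ∑ i, ‖v i‖ ^ 2 :=
  Real.sq_sqrt (Finset.sum_nonneg fun _ _ => sq_nonneg _)

theorem famNorm_congr {v : ι → H} {w : κ → H} (h : ∑ i, ‖v i‖ ^ 2 = ∑ j, ‖w j‖ ^ 2) :
    famNorm v = famNorm w := by rw [famNorm, famNorm, h]

theorem famNorm_add_le (v w : ι → H) : famNorm (v + w) ≤ famNorm v + famNorm w := by
  have h := norm_add_le (WithLp.toLp 2 v : PiLp 2 fun _ : ι => H) (WithLp.toLp 2 w)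
  rw [← WithLp.toLp_add, PiLp.norm_eq_of_L2, PiLp.norm_eq_of_L2, PiLp.norm_eq_of_L2] at h
  exact h

theorem famNorm_sub_le (u v w : ι → H) : famNorm (u - w) ≤ famNorm (u - v) + famNorm (v - w) := by
  simpa using famNorm_add_le (u - v) (v - w)

theorem famNorm_sub_comm (v w : ι → H) : famNorm (v - w) = famNorm (w - v) :=
  famNorm_congr (by simp [norm_sub_rev])

theorem famNorm_equiv (e : κ ≃ ι) (v : ι → H) : famNorm (fun k => v (e k)) = famNorm v :=
  famNorm_congr (e.sum_comp fun i => ‖v i‖ ^ 2)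

end FamilyNorm

/-! ### Sequential measurements and their disturbance. -/

section Sequential

variable {Q : Type*} {A B : Type*}
  {H : Type*} [NormedAddCommGroup H] [InnerProductSpace ℂ H]

/-- Kraus operators of a measurement: `∑ a, (K a)† K a = 1`. -/
def IsKraus [Fintype A] (K : A → H →L[ℂ] H) : Prop := ∀ φ, ∑ a, ‖K a φ‖ ^ 2 = ‖φ‖ ^ 2

/-- The Kraus operator of measuring `e 0`, `e 1`, … in this order with outcomes `x 0`, `x 1`, …. -/
noncomputable def seqOp (K : Q → A → H →L[ℂ] H) : (n : ℕ) → (Fin n → Q) → (Fin n → A) → H →L[ℂ] H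
  | 0, _, _ => 1
  | n + 1, e, x => seqOp K n (Fin.tail e) (Fin.tail x) * K (e 0) (x 0)

/-- The same as `seqOp`, with the measurement in place `m` left out. -/
noncomputable def skipOp (K : Q → A → H →L[ℂ] H) :
    (n : ℕ) → (Fin n → Q) → (Fin n → A) → Fin n → H →L[ℂ] H
  | 0, _, _ => fun m => m.elim0
  | n + 1, e, x => Fin.cases (seqOp K n (Fin.tail e) (Fin.tail x))
      (fun m => skipOp K n (Fin.tail e) (Fin.tail x) m * K (e 0) (x 0))

variable {K L : Q → A → H →L[ℂ] H}

theorem Commute.apply_apply {S T : H →L[ℂ] H} (h : Commute S T) (φ : H) : S (T φ) = T (S φ) :=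
  DFunLike.congr_fun h.eq φ

theorem commute_seqOp {T : H →L[ℂ] H} (h : ∀ q a, Commute T (K q a)) :
    ∀ (n : ℕ) (e : Fin n → Q) (x : Fin n → A), Commute T (seqOp K n e x)
  | 0, _, _ => Commute.one_right T
  | n + 1, _, _ => (commute_seqOp h n _ _).mul_right (h _ _)

theorem commute_skipOp {T : H →L[ℂ] H} (h : ∀ q a, Commute T (K q a)) :
    ∀ (n : ℕ) (e : Fin n → Q) (x : Fin n → A) (m : Fin n), Commute T (skipOp K n e x m)
  | 0, _, _, m => m.elim0
  | n + 1, e, x, m => by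
    cases m using Fin.cases with
    | zero => exact commute_seqOp h n _ _
    | succ m => exact (commute_skipOp h n _ _ m).mul_right (h _ _)

variable [Fintype A] [Fintype B]

theorem sum_fin_succ_fun {M : Type*} [AddCommMonoid M] {n : ℕ} (f : (Fin (n + 1) → A) → M) :
    ∑ x, f x = ∑ a, ∑ y, f (Fin.cons a y) := by
  rw [← (Fin.consEquiv fun _ : Fin (n + 1) => A).sum_comp, Fintype.sum_prod_type]
  rfl

theorem sum_seqOp (hK : ∀ q, IsKraus (K q)) :
    ∀ (n : ℕ) (e : Fin n → Q) (φ : H), ∑ x, ‖seqOp K n e x φ‖ ^ 2 = ‖φ‖ ^ 2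
  | 0, e, φ => by simp [seqOp]
  | n + 1, e, φ => by
    rw [sum_fin_succ_fun]
    simp only [seqOp, Fin.tail_cons, Fin.cons_zero, mul_apply_eq_comp]
    simp only [sum_seqOp hK n]
    exact hK _ φ

/-- The omitted measurement leaves `x m` as a free label, so the input vector may depend on it; the
remaining measurements preserve total norm for each value of the label. -/
theorem sum_skipOp (hK : ∀ q, IsKraus (K q)) :
    ∀ (n : ℕ) (e : Fin n → Q) (m : Fin n) (φ : A → H),
      ∑ x, ‖skipOp K n e x m (φ (x m))‖ ^ 2 = ∑ b, ‖φ b‖ ^ 2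
  | 0, _, m, _ => m.elim0
  | n + 1, e, m, φ => by
    rw [sum_fin_succ_fun]
    cases m using Fin.cases with
    | zero =>
      simp only [skipOp, Fin.tail_cons, Fin.cons_zero, Fin.cases_zero]
      simp only [sum_seqOp hK n]
    | succ m =>
      simp only [skipOp, Fin.tail_cons, Fin.cons_zero, Fin.cases_succ, Fin.cons_succ,
        mul_apply_eq_comp]
      rw [Finset.sum_congr rfl fun a _ =>
        sum_skipOp hK n (Fin.tail e) m (fun b => K (e 0) a (φ b)), Finset.sum_comm]
      exact Finset.sum_congr rfl fun b _ => hK _ _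

/-- Measuring the question in place `m` first disturbs the outcome of a sequence of measurements
little when that measurement nearly commutes with the earlier ones and these are nearly the same
as measurements that commute with all the others. -/
theorem famNorm_seqOp_sub_skipOp_le (hK : ∀ q, IsKraus (K q)) (hL : ∀ q, IsKraus (L q))
    (hLK : ∀ q a q' a', Commute (L q a) (K q' a')) (ψ : H) :
    ∀ (n : ℕ) (e : Fin n → Q) (m : Fin n),
      famNorm ((fun x => seqOp K n e x ψ) - fun x => skipOp K n e x m (K (e m) (x m) ψ)) ≤
        ∑ i, if i < m then 2 * famNorm ((fun a => K (e i) a ψ) - fun a => L (e i) a ψ) +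
          famNorm ((fun p : A × A => K (e m) p.1 (K (e i) p.2 ψ)) -
            fun p => K (e i) p.2 (K (e m) p.1 ψ)) else 0
  | 0, _, m => m.elim0
  | n + 1, e, m => by
    cases m using Fin.cases with
    | zero =>
      have : (fun x => seqOp K (n + 1) e x ψ) -
          (fun x => skipOp K (n + 1) e x 0 (K (e 0) (x 0) ψ)) = 0 := by
        funext x; simp [seqOp, skipOp]
      rw [this]
      simp [famNorm]
    | succ m =>
      have ih := famNorm_seqOp_sub_skipOp_le hK hL hLK ψ n (Fin.tail e) m
      rw [Fin.sum_univ_succ]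
      simp only [Fin.succ_pos, if_true, Fin.succ_lt_succ_iff]
      simp only [Fin.tail] at ih
      set S := seqOp K n (Fin.tail e) with hS
      set R := fun y => skipOp K n (Fin.tail e) y m with hR
      have hLS : ∀ q a y φ, L q a (S y φ) = S y (L q a φ) := fun q a y φ =>
        (commute_seqOp (hLK q a) n _ y).apply_apply φ
      have hLR : ∀ q a y φ, L q a (R y φ) = R y (L q a φ) := fun q a y φ =>
        (commute_skipOp (hLK q a) n _ y m).apply_apply φ
      have hLKφ : ∀ q a q' a' φ, L q a (K q' a' φ) = K q' a' (L q a φ) := fun q a q' a' φ =>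
        (hLK q a q' a').apply_apply φ
      -- On ψ, the first K is replaced by L, which moves to the left of everything; the inductive
      -- hypothesis then applies to ψ itself. L is moved back next to ψ and turned into K again, and
      -- one commutator on ψ remains. The two replacements give the factor 2.
      let V₀ : A × (Fin n → A) → H := fun p => S p.2 (K (e 0) p.1 ψ)
      let V₁ : A × (Fin n → A) → H := fun p => L (e 0) p.1 (S p.2 ψ)
      let V₂ : A × (Fin n → A) → H := fun p => L (e 0) p.1 (R p.2 (K (e m.succ) (p.2 m) ψ))
      let V₃ : A × (Fin n → A) → H := fun p => R p.2 (K (e m.succ) (p.2 m) (K (e 0) p.1 ψ))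
      let V₄ : A × (Fin n → A) → H := fun p => R p.2 (K (e 0) p.1 (K (e m.succ) (p.2 m) ψ))
      have h₀ : famNorm ((fun x => seqOp K (n + 1) e x ψ) -
          fun x => skipOp K (n + 1) e x m.succ (K (e m.succ) (x m.succ) ψ)) =
          famNorm (V₀ - V₄) := by
        rw [← famNorm_equiv (Fin.consEquiv fun _ : Fin (n + 1) => A)]
        refine congrArg famNorm ?_
        funext p
        simp [V₀, V₄, seqOp, skipOp, Fin.consEquiv, hS, hR]
      have h₁ : famNorm (V₀ - V₁) = famNorm ((fun a => K (e 0) a ψ) - fun a => L (e 0) a ψ) := by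
        refine famNorm_congr ?_
        rw [Fintype.sum_prod_type]
        refine Finset.sum_congr rfl fun a _ => ?_
        simp only [Pi.sub_apply, V₀, V₁, hLS, ← map_sub]
        exact sum_seqOp hK n _ _
      have h₂ : famNorm (V₁ - V₂) =
          famNorm ((fun y => S y ψ) - fun y => R y (K (e m.succ) (y m) ψ)) := by
        refine famNorm_congr ?_
        rw [Fintype.sum_prod_type, Finset.sum_comm]
        refine Finset.sum_congr rfl fun y _ => ?_
        simp only [Pi.sub_apply, V₁, V₂, ← map_sub]
        exact hL _ _
      have h₃ : famNorm (V₂ - V₃) = famNorm ((fun a => K (e 0) a ψ) - fun a => L (e 0) a ψ) := by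
        rw [famNorm_sub_comm (fun a => K (e 0) a ψ)]
        refine famNorm_congr ?_
        rw [Fintype.sum_prod_type]
        refine Finset.sum_congr rfl fun a _ => ?_
        simp only [Pi.sub_apply, V₂, V₃, hLR, hLKφ, ← map_sub]
        refine (sum_skipOp hK n _ m
          (fun b => K (e m.succ) b (L (e 0) a ψ - K (e 0) a ψ))).trans (hK _ _)
      have h₄ : famNorm (V₃ - V₄) =
          famNorm ((fun p : A × A => K (e m.succ) p.1 (K (e 0) p.2 ψ)) -
            fun p => K (e 0) p.2 (K (e m.succ) p.1 ψ)) := by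
        refine famNorm_congr ?_
        rw [Fintype.sum_prod_type, Fintype.sum_prod_type, Finset.sum_comm (s := Finset.univ (α := A))]
        rw [Finset.sum_comm]
        conv_rhs => rw [Finset.sum_comm]
        refine Finset.sum_congr rfl fun a _ => ?_
        simp only [Pi.sub_apply, V₃, V₄, ← map_sub]
        exact sum_skipOp hK n _ m
          (fun b => K (e m.succ) b (K (e 0) a ψ) - K (e 0) a (K (e m.succ) b ψ))
      have t₁ := famNorm_sub_le V₀ V₁ V₄
      have t₂ := famNorm_sub_le V₁ V₂ V₄
      have t₃ := famNorm_sub_le V₂ V₃ V₄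
      rw [h₀]
      linarith

/-- `famNorm_commutator_le` for one order of the two measurements. -/
theorem famNorm_pair_sub_le [DecidableEq A] {K₁ K₂ L₁ L₂ : A → H →L[ℂ] H} {J : B → H →L[ℂ] H}
    (α β : B → A) (hK₁ : IsKraus K₁) (hL₂ : IsKraus L₂) (hJ : IsKraus J)
    (h₂₁ : ∀ a b, Commute (L₂ a) (K₁ b)) (hJ₁ : ∀ a b, Commute (L₁ a) (J b))
    (hJ₂ : ∀ a b, Commute (L₂ a) (J b)) (ψ : H) :
    famNorm ((fun p : B × A × A => J p.1 (K₁ p.2.1 (K₂ p.2.2 ψ))) -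
      fun p => if α p.1 = p.2.1 ∧ β p.1 = p.2.2 then J p.1 ψ else 0) ≤
    famNorm ((fun a => K₁ a ψ) - fun a => L₁ a ψ) + famNorm ((fun a => K₂ a ψ) - fun a => L₂ a ψ) +
    famNorm ((fun p : B × A => L₁ p.2 (J p.1 ψ)) - fun p => if α p.1 = p.2 then J p.1 ψ else 0) +
    famNorm ((fun p : B × A => L₂ p.2 (J p.1 ψ)) -
      fun p => if β p.1 = p.2 then J p.1 ψ else 0) := by
  -- Each K is exchanged for its L while it acts directly on ψ, with L₂ moved out of the way before
  -- K₁ is treated. The L's then stand to the left of J, whose outcome predicts theirs.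
  let V₀ : B × A × A → H := fun p => J p.1 (K₁ p.2.1 (K₂ p.2.2 ψ))
  let V₁ : B × A × A → H := fun p => J p.1 (K₁ p.2.1 (L₂ p.2.2 ψ))
  let V₂ : B × A × A → H := fun p => L₂ p.2.2 (J p.1 (L₁ p.2.1 ψ))
  let V₃ : B × A × A → H := fun p => L₂ p.2.2 (if α p.1 = p.2.1 then J p.1 ψ else 0)
  let V₄ : B × A × A → H := fun p => if α p.1 = p.2.1 ∧ β p.1 = p.2.2 then J p.1 ψ else 0
  have h₁ : famNorm (V₀ - V₁) = famNorm ((fun a => K₂ a ψ) - fun a => L₂ a ψ) := by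
    refine famNorm_congr ?_
    simp only [Fintype.sum_prod_type, Pi.sub_apply, V₀, V₁, ← map_sub]
    rw [Finset.sum_comm]
    simp only [Finset.sum_comm (γ := B), hJ _]
    rw [Finset.sum_comm]
    simp only [hK₁ _]
  have h₂ : famNorm (V₁ - V₂) = famNorm ((fun a => K₁ a ψ) - fun a => L₁ a ψ) := by
    refine famNorm_congr ?_
    simp only [Fintype.sum_prod_type, Pi.sub_apply, V₁, V₂, (hJ₂ _ _).apply_apply,
      ← (h₂₁ _ _).apply_apply]
    simp only [← (hJ₂ _ _).apply_apply, ← map_sub, hL₂ _]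
    rw [Finset.sum_comm]
    simp only [hJ _]
  have h₃ : famNorm (V₂ - V₃) = famNorm ((fun p : B × A => L₁ p.2 (J p.1 ψ)) -
      fun p => if α p.1 = p.2 then J p.1 ψ else 0) := by
    refine famNorm_congr ?_
    simp only [Fintype.sum_prod_type, Pi.sub_apply, V₂, V₃, ← (hJ₁ _ _).apply_apply, ← map_sub]
    exact Finset.sum_congr rfl fun c _ => Finset.sum_congr rfl fun a _ =>
      hL₂ (L₁ a (J c ψ) - if α c = a then J c ψ else 0)
  have h₄ : famNorm (V₃ - V₄) = famNorm ((fun p : B × A => L₂ p.2 (J p.1 ψ)) -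
      fun p => if β p.1 = p.2 then J p.1 ψ else 0) := by
    refine famNorm_congr ?_
    simp only [Fintype.sum_prod_type, Pi.sub_apply, V₃, V₄]
    refine Finset.sum_congr rfl fun c _ => ?_
    rw [Finset.sum_eq_single (α c)]
    · simp
    · intro a _ ha
      simp [ha.symm]
    · simp
  have t₁ := famNorm_sub_le V₀ V₁ V₄
  have t₂ := famNorm_sub_le V₁ V₂ V₄
  have t₃ := famNorm_sub_le V₂ V₃ V₄
  linarith

/-- Two measurements nearly commute when they are both consistent, through measurements `L₁`, `L₂`
on the other side, with the marginals `α`, `β` of one joint measurement `J`. -/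
theorem famNorm_commutator_le [DecidableEq A] {K₁ K₂ L₁ L₂ : A → H →L[ℂ] H} {J : B → H →L[ℂ] H}
    (α β : B → A) (hK₁ : IsKraus K₁) (hK₂ : IsKraus K₂) (hL₁ : IsKraus L₁) (hL₂ : IsKraus L₂)
    (hJ : IsKraus J) (h₁₂ : ∀ a b, Commute (L₁ a) (K₂ b)) (h₂₁ : ∀ a b, Commute (L₂ a) (K₁ b))
    (hJ₁ : ∀ a b, Commute (L₁ a) (J b)) (hJ₂ : ∀ a b, Commute (L₂ a) (J b)) (ψ : H) :
    famNorm ((fun p : A × A => K₁ p.1 (K₂ p.2 ψ)) - fun p => K₂ p.2 (K₁ p.1 ψ)) ≤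
    2 * (famNorm ((fun a => K₁ a ψ) - fun a => L₁ a ψ) +
      famNorm ((fun a => K₂ a ψ) - fun a => L₂ a ψ) +
      famNorm ((fun p : B × A => L₁ p.2 (J p.1 ψ)) - fun p => if α p.1 = p.2 then J p.1 ψ else 0) +
      famNorm ((fun p : B × A => L₂ p.2 (J p.1 ψ)) -
        fun p => if β p.1 = p.2 then J p.1 ψ else 0)) := by
  have h := famNorm_pair_sub_le (K₂ := K₂) α β hK₁ hL₂ hJ h₂₁ hJ₁ hJ₂ ψ
  have h' := famNorm_pair_sub_le (K₂ := K₁) β α hK₂ hL₁ hJ h₁₂ hJ₂ hJ₁ ψ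
  -- Applying J on the left does not change the norm and gives both orders a common target,
  -- symmetric in the two outcomes.
  have h₀ : famNorm ((fun p : A × A => K₁ p.1 (K₂ p.2 ψ)) - fun p => K₂ p.2 (K₁ p.1 ψ)) =
      famNorm ((fun p : B × A × A => J p.1 (K₁ p.2.1 (K₂ p.2.2 ψ))) -
        fun p => J p.1 (K₂ p.2.2 (K₁ p.2.1 ψ))) := by
    refine famNorm_congr ?_
    rw [Fintype.sum_prod_type (α₁ := B), Finset.sum_comm]
    simp only [Pi.sub_apply, ← map_sub, hJ _]
  rw [h₀]
  refine (famNorm_sub_le _ (fun p : B × A × A =>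
    if α p.1 = p.2.1 ∧ β p.1 = p.2.2 then J p.1 ψ else 0) _).trans ?_
  rw [famNorm_sub_comm (fun p : B × A × A => if α p.1 = p.2.1 ∧ β p.1 = p.2.2 then J p.1 ψ else 0)]
  have h'' : famNorm ((fun p : B × A × A => J p.1 (K₂ p.2.1 (K₁ p.2.2 ψ))) -
      fun p => if β p.1 = p.2.1 ∧ α p.1 = p.2.2 then J p.1 ψ else 0) =
      famNorm ((fun p : B × A × A => J p.1 (K₂ p.2.2 (K₁ p.2.1 ψ))) -
        fun p => if α p.1 = p.2.1 ∧ β p.1 = p.2.2 then J p.1 ψ else 0) := by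
    rw [← famNorm_equiv ((Equiv.refl B).prodCongr (Equiv.prodComm A A))]
    refine congrArg famNorm ?_
    funext p
    simp [and_comm]
  rw [h''] at h'
  linarith

end Sequential

/-! ### POVMs, square roots and agreement. -/

section Operators

variable {A : Type u} {B : Type u₁} [Fintype A] [Fintype B]
  {H : Type v} [NormedAddCommGroup H] [InnerProductSpace ℂ H]

/-- The coarse-graining of a measurement along a function of the outcome. -/
noncomputable def coarsen [DecidableEq A] (g : B → A) (E : B → H →L[ℂ] H) (a : A) : H →L[ℂ] H :=
  ∑ b, if g b = a then E b else 0

/-- The probability that the measurements `E` and `F` give the same outcome in the state `ψ`. -/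
noncomputable def agreeProb (ψ : H) (E F : A → H →L[ℂ] H) : ℝ :=
  ∑ a, (inner ℂ ψ (E a (F a ψ))).re

theorem famNorm_sub_sq {ι : Type*} [Fintype ι] (v w : ι → H) :
    famNorm (v - w) ^ 2 = ∑ i, ‖v i‖ ^ 2 - 2 * ∑ i, (inner ℂ (v i) (w i)).re + ∑ i, ‖w i‖ ^ 2 := by
  rw [famNorm_sq, Finset.mul_sum, ← Finset.sum_sub_distrib, ← Finset.sum_add_distrib]
  exact Finset.sum_congr rfl fun i _ => norm_sub_sq (𝕜 := ℂ) _ _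

theorem IsPOVM.nonneg {E : A → H →L[ℂ] H} (hE : IsPOVM E) (a : A) : 0 ≤ E a :=
  (ContinuousLinearMap.nonneg_iff_isPositive _).2 (hE.1 a)

theorem isPOVM_of_nonneg {E : A → H →L[ℂ] H} (h : ∀ a, 0 ≤ E a) (h' : ∑ a, E a = 1) : IsPOVM E :=
  ⟨fun a => (ContinuousLinearMap.nonneg_iff_isPositive _).1 (h a), h'⟩

theorem re_inner_nonneg {T : H →L[ℂ] H} (hT : 0 ≤ T) (ψ : H) : 0 ≤ (inner ℂ ψ (T ψ)).re :=
  ((ContinuousLinearMap.nonneg_iff_isPositive _).1 hT).re_inner_nonneg_right ψ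

variable [CompleteSpace H]

theorem IsPOVM.le_one {E : A → H →L[ℂ] H} (hE : IsPOVM E) (a : A) : E a ≤ 1 := by
  rw [← hE.2]
  exact Finset.single_le_sum (fun b _ => hE.nonneg b) (Finset.mem_univ a)

theorem IsPOVM.coarsen [DecidableEq A] {E : B → H →L[ℂ] H} (hE : IsPOVM E) (g : B → A) :
    IsPOVM (coarsen g E) := by
  refine isPOVM_of_nonneg (fun a => Finset.sum_nonneg fun b _ => ?_) ?_
  · split_ifs
    · exact hE.nonneg b
    · exact le_rfl
  · unfold _root_.coarsen
    rw [Finset.sum_comm]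
    simp [hE.2]

theorem isPOVM_sum_smul {ι : Type*} [Fintype ι] {c : ι → ℝ} (hc : c ∈ stdSimplex ℝ ι)
    {E : ι → A → H →L[ℂ] H} (hE : ∀ i, IsPOVM (E i)) : IsPOVM fun a => ∑ i, c i • E i a := by
  refine isPOVM_of_nonneg (fun a => Finset.sum_nonneg fun i _ => ?_) ?_
  · rw [ContinuousLinearMap.nonneg_iff_isPositive]
    have := ((hE i).1 a).smul_of_nonneg (c := (c i : ℂ)) (by exact_mod_cast hc.1 i)
    simpa using! this
  · rw [Finset.sum_comm]
    simp only [← Finset.smul_sum, (hE _).2, ← Finset.sum_smul, hc.2, one_smul]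

theorem re_inner_mono {S T : H →L[ℂ] H} (h : S ≤ T) (ψ : H) :
    (inner ℂ ψ (S ψ)).re ≤ (inner ℂ ψ (T ψ)).re := by
  have := re_inner_nonneg (sub_nonneg.2 h) ψ
  simpa [inner_sub_right] using this

theorem commute_sqrt {S T : H →L[ℂ] H} (h : Commute S T) : Commute S (CFC.sqrt T) := by
  rw [CFC.sqrt]
  exact (h.symm.cfcₙ_nnreal _).symm

theorem inner_sqrt_apply (T : H →L[ℂ] H) (φ χ : H) :
    inner ℂ (CFC.sqrt T φ) χ = inner ℂ φ (CFC.sqrt T χ) :=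
  ((ContinuousLinearMap.nonneg_iff_isPositive _).1 (CFC.sqrt_nonneg T)).isSymmetric φ χ

theorem sqrt_apply_sqrt_apply {T : H →L[ℂ] H} (hT : 0 ≤ T) (φ : H) :
    CFC.sqrt T (CFC.sqrt T φ) = T φ :=
  DFunLike.congr_fun (CFC.sqrt_mul_sqrt_self T hT) φ

theorem norm_sqrt_apply_sq {T : H →L[ℂ] H} (hT : 0 ≤ T) (φ : H) :
    ‖CFC.sqrt T φ‖ ^ 2 = (inner ℂ φ (T φ)).re := by
  rw [← sqrt_apply_sqrt_apply hT φ, ← inner_sqrt_apply, inner_self_eq_norm_sq_to_K]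
  norm_cast

theorem IsPOVM.isKraus {E : A → H →L[ℂ] H} (hE : IsPOVM E) : IsKraus fun a => CFC.sqrt (E a) := by
  intro φ
  simp only [norm_sqrt_apply_sq (hE.nonneg _), ← Complex.re_sum, ← inner_sum,
    ← sum_apply, hE.2]
  rw [one_apply_eq_self, inner_self_eq_norm_sq_to_K]
  norm_cast

/-- √T - T = √T (1 - √T) is a product of commuting nonnegative operators. -/
theorem le_sqrt_of_le_one {T : H →L[ℂ] H} (h₀ : 0 ≤ T) (h₁ : T ≤ 1) : T ≤ CFC.sqrt T := by
  have h : CFC.sqrt T ≤ 1 := by simpa using CFC.sqrt_le_sqrt T 1 h₁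
  have := Commute.mul_nonneg (CFC.sqrt_nonneg T) (sub_nonneg.2 h)
    ((Commute.one_right _).sub_right (Commute.refl _))
  rwa [mul_sub, mul_one, CFC.sqrt_mul_sqrt_self T h₀, sub_nonneg] at this

/-- The difference is √S (√T - T) + (√S - S) T, and both terms are products of commuting nonnegative
operators. -/
theorem mul_le_sqrt_mul_sqrt {S T : H →L[ℂ] H} (h : Commute S T) (hS : 0 ≤ S) (hS' : S ≤ 1)
    (hT : 0 ≤ T) (hT' : T ≤ 1) : S * T ≤ CFC.sqrt S * CFC.sqrt T := by
  have h₁ := Commute.mul_nonneg (CFC.sqrt_nonneg S) (sub_nonneg.2 (le_sqrt_of_le_one hT hT'))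
    ((commute_sqrt (commute_sqrt h.symm).symm).sub_right (commute_sqrt h.symm).symm)
  have h₂ := Commute.mul_nonneg (sub_nonneg.2 (le_sqrt_of_le_one hS hS')) hT
    ((commute_sqrt h.symm).symm.sub_left h)
  have := add_nonneg h₁ h₂
  rw [← sub_nonneg]
  convert this using 1
  noncomm_ring

/-- Commuting measurements with agreeing outcomes have nearly the same Kraus operators. -/
theorem famNorm_sqrt_sub_sqrt_sq_le {E F : A → H →L[ℂ] H} (hE : IsPOVM E) (hF : IsPOVM F)
    (h : ∀ a b, Commute (E a) (F b)) {ψ : H} (hψ : ‖ψ‖ = 1) :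
    famNorm ((fun a => CFC.sqrt (F a) ψ) - fun a => CFC.sqrt (E a) ψ) ^ 2 ≤
      2 * (1 - agreeProb ψ E F) := by
  rw [famNorm_sub_comm, famNorm_sub_sq, hE.isKraus ψ, hF.isKraus ψ, hψ]
  have : agreeProb ψ E F ≤ ∑ a, (inner ℂ (CFC.sqrt (E a) ψ) (CFC.sqrt (F a) ψ)).re := by
    refine Finset.sum_le_sum fun a _ => ?_
    rw [inner_sqrt_apply]
    exact re_inner_mono (mul_le_sqrt_mul_sqrt (h a a) (hE.nonneg a) (hE.le_one a)
      (hF.nonneg a) (hF.le_one a)) ψ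
  linarith

/-- The Kraus operators of a measurement are nearly the projections onto the outcomes of a finer
measurement that commutes with it and agrees with it. -/
theorem famNorm_sqrt_apply_sub_sq_le [DecidableEq A] {E : A → H →L[ℂ] H} {G : B → H →L[ℂ] H}
    (α : B → A) (hE : IsPOVM E) (hG : IsPOVM G) (h : ∀ a b, Commute (E a) (G b)) {ψ : H}
    (hψ : ‖ψ‖ = 1) :
    famNorm ((fun p : B × A => CFC.sqrt (E p.2) (CFC.sqrt (G p.1) ψ)) -
      fun p => if α p.1 = p.2 then CFC.sqrt (G p.1) ψ else 0) ^ 2 ≤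
      2 * (1 - agreeProb ψ E (coarsen α G)) := by
  rw [famNorm_sub_sq, Fintype.sum_prod_type, Fintype.sum_prod_type, Fintype.sum_prod_type]
  have h₁ : ∑ c, ∑ a, ‖CFC.sqrt (E a) (CFC.sqrt (G c) ψ)‖ ^ 2 = 1 := by
    rw [Finset.sum_congr rfl fun c _ => hE.isKraus (CFC.sqrt (G c) ψ), hG.isKraus ψ, hψ, one_pow]
  have h₂ : ∑ c, ∑ a, ‖if α c = a then CFC.sqrt (G c) ψ else 0‖ ^ 2 = 1 := by
    have : ∀ c a, ‖if α c = a then CFC.sqrt (G c) ψ else 0‖ ^ 2 =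
        if α c = a then ‖CFC.sqrt (G c) ψ‖ ^ 2 else 0 := by
      intro c a
      split_ifs <;> simp
    simp only [this, Finset.sum_ite_eq, Finset.mem_univ, if_true]
    rw [hG.isKraus ψ, hψ, one_pow]
  have h₃ : agreeProb ψ E (coarsen α G) ≤ ∑ c, ∑ a,
      (inner ℂ (CFC.sqrt (E a) (CFC.sqrt (G c) ψ))
        (if α c = a then CFC.sqrt (G c) ψ else 0)).re := by
    have h₄ : agreeProb ψ E (coarsen α G) = ∑ c, (inner ℂ ψ (E (α c) (G c ψ))).re := by
      simp only [agreeProb, coarsen, sum_apply, map_sum, inner_sum,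
        Complex.re_sum]
      rw [Finset.sum_comm]
      refine Finset.sum_congr rfl fun c _ => ?_
      rw [Finset.sum_eq_single (α c)]
      · simp
      · intro a _ ha
        simp [ha.symm]
      · simp
    rw [h₄]
    -- Only the outcome `α c` survives; its cross term is ⟨ψ, √E G ψ⟩, and E ≤ √E.
    refine Finset.sum_le_sum fun c _ => ?_
    rw [Finset.sum_eq_single (α c)]
    · rw [if_pos rfl, inner_sqrt_apply, inner_sqrt_apply,
        ← (commute_sqrt (commute_sqrt (h (α c) c)).symm).symm.symm.apply_apply,
        sqrt_apply_sqrt_apply (hG.nonneg c)]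
      rw [← (commute_sqrt (h (α c) c).symm).symm.apply_apply]
      exact re_inner_mono (S := E (α c) * G c) (T := CFC.sqrt (E (α c)) * G c) (by
        have := Commute.mul_nonneg (sub_nonneg.2 (le_sqrt_of_le_one (hE.nonneg (α c))
          (hE.le_one (α c)))) (hG.nonneg c)
          ((commute_sqrt (h (α c) c).symm).symm.sub_left (h _ _))
        rwa [sub_mul, sub_nonneg] at this) ψ
    · intro a _ ha
      simp [ha.symm]
    · simp
  rw [h₁, h₂]
  linarith

end Operators

/-! ### Unentangled strategies as averages of deterministic ones. -/

namespace TwoProverGame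

open MeasureTheory

variable {Q₁ : Type u₁} {Q₂ : Type u₂} {S : Type u₃} {A₁ : Type u₄} {A₂ : Type u₅}

open Classical in
/-- The strategy of provers that answer by the functions `f₁` and `f₂`. -/
noncomputable def deterministic (f₁ : Q₁ → A₁) (f₂ : Q₂ → A₂) : Q₁ → Q₂ → A₁ → A₂ → ℝ :=
  fun q₁ q₂ a₁ a₂ => if f₁ q₁ = a₁ ∧ f₂ q₂ = a₂ then 1 else 0

theorem isUnentangled_deterministic (f₁ : Q₁ → A₁) (f₂ : Q₂ → A₂) :
    IsUnentangled.{w} (deterministic f₁ f₂) := by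
  refine ⟨PUnit, PUnit, PUnit, ⊤, ⊤, ⊤, Measure.dirac PUnit.unit, Measure.dirac PUnit.unit,
    Measure.dirac PUnit.unit, fun q _ => f₁ q, fun q _ => f₂ q, inferInstance, inferInstance,
    inferInstance, fun q a => ?_, fun q a => ?_, fun q₁ q₂ a₁ a₂ => ?_⟩
  · by_cases h : f₁ q = a <;> simp [h]
  · by_cases h : f₂ q = a <;> simp [h]
  · by_cases h : f₁ q₁ = a₁ ∧ f₂ q₂ = a₂ <;> simp [h, deterministic]

open Classical in
theorem sum_deterministic_mul [Fintype A₁] [Fintype A₂] (f₁ : Q₁ → A₁) (f₂ : Q₂ → A₂) (q₁ : Q₁) (q₂ : Q₂)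
    (g : A₁ → A₂ → ℝ) :
    ∑ a₁, ∑ a₂, deterministic f₁ f₂ q₁ q₂ a₁ a₂ * g a₁ a₂ = g (f₁ q₁) (f₂ q₂) := by
  rw [Finset.sum_eq_single (f₁ q₁), Finset.sum_eq_single (f₂ q₂)]
  · simp [deterministic]
  · intro a _ ha
    simp [deterministic, ha.symm]
  · simp
  · intro a _ ha
    simp [deterministic, ha.symm]
  · simp

variable [Fintype Q₁] [Fintype Q₂] [Fintype S] [Fintype A₁] [Fintype A₂]

theorem winProb_integral (G : TwoProverGame Q₁ Q₂ S A₁ A₂) {Ω : Type*} [MeasurableSpace Ω]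
    (μ : Measure Ω) (Θ : Ω → Q₁ → Q₂ → A₁ → A₂ → ℝ)
    (h : ∀ q₁ q₂ a₁ a₂, Integrable (fun ω => Θ ω q₁ q₂ a₁ a₂) μ) :
    G.winProb (fun q₁ q₂ a₁ a₂ => ∫ ω, Θ ω q₁ q₂ a₁ a₂ ∂μ) = ∫ ω, G.winProb (Θ ω) ∂μ ∧
      Integrable (fun ω => G.winProb (Θ ω)) μ := by
  classical
  have h₁ : ∀ q₁ q₂ s a₁ a₂, Integrable (fun ω => Θ ω q₁ q₂ a₁ a₂ *
      (if G.R q₁ q₂ s a₁ a₂ then 1 else 0 : ℝ)) μ := fun q₁ q₂ s a₁ a₂ => (h _ _ _ _).mul_const _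
  have h₂ : ∀ q₁ q₂ s, Integrable (fun ω => G.π (q₁, q₂, s) * ∑ a₁, ∑ a₂, Θ ω q₁ q₂ a₁ a₂ *
      (if G.R q₁ q₂ s a₁ a₂ then 1 else 0 : ℝ)) μ := fun q₁ q₂ s =>
    (integrable_finsetSum _ fun a₁ _ => integrable_finsetSum _ fun a₂ _ =>
      h₁ q₁ q₂ s a₁ a₂).const_mul _
  constructor
  · simp only [winProb]
    rw [integral_finsetSum _ fun q₁ _ => integrable_finsetSum _ fun q₂ _ =>
      integrable_finsetSum _ fun s _ => by convert h₂ q₁ q₂ s]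
    refine Finset.sum_congr rfl fun q₁ _ => ?_
    rw [integral_finsetSum _ fun q₂ _ => integrable_finsetSum _ fun s _ => by
      convert h₂ q₁ q₂ s]
    refine Finset.sum_congr rfl fun q₂ _ => ?_
    rw [integral_finsetSum _ fun s _ => by convert h₂ q₁ q₂ s]
    refine Finset.sum_congr rfl fun s _ => ?_
    rw [integral_const_mul, integral_finsetSum _ fun a₁ _ => integrable_finsetSum _ fun a₂ _ => by
      convert h₁ q₁ q₂ s a₁ a₂]
    refine congrArg _ (Finset.sum_congr rfl fun a₁ _ => ?_)
    rw [integral_finsetSum _ fun a₂ _ => by convert h₁ q₁ q₂ s a₁ a₂]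
    exact Finset.sum_congr rfl fun a₂ _ => (integral_mul_const _ _).symm
  · simp only [winProb]
    exact integrable_finsetSum _ fun q₁ _ => integrable_finsetSum _ fun q₂ _ =>
      integrable_finsetSum _ fun s _ => by convert h₂ q₁ q₂ s

theorem winProb_hasSum (G : TwoProverGame Q₁ Q₂ S A₁ A₂) {Θ : ℕ → Q₁ → Q₂ → A₁ → A₂ → ℝ}
    {θ : Q₁ → Q₂ → A₁ → A₂ → ℝ}
    (h : ∀ q₁ q₂ a₁ a₂, HasSum (fun k => Θ k q₁ q₂ a₁ a₂) (θ q₁ q₂ a₁ a₂)) :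
    HasSum (fun k => G.winProb (Θ k)) (G.winProb θ) :=
  hasSum_sum fun q₁ _ => hasSum_sum fun q₂ _ => hasSum_sum fun _ _ =>
    (hasSum_sum fun a₁ _ => hasSum_sum fun a₂ _ => (h q₁ q₂ a₁ a₂).mul_right _).mul_left _

/-- A bound on the deterministic strategies holds for the unentangled ones. -/
theorem winProb_le_of_isUnentangled (G : TwoProverGame Q₁ Q₂ S A₁ A₂) {c : ℝ}
    (hc : ∀ f₁ f₂, G.winProb (deterministic f₁ f₂) ≤ c) {θ : Q₁ → Q₂ → A₁ → A₂ → ℝ}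
    (hθ : IsUnentangled.{w} θ) : G.winProb θ ≤ c := by
  classical
  obtain ⟨Ω, Ω₁, Ω₂, _, _, _, μ, μ₁, μ₂, f₁, f₂, hμ, hμ₁, hμ₂, hf₁, hf₂, h⟩ := hθ
  -- Fixing the outcomes of all three sources leaves a deterministic strategy, and the winning
  -- probability is linear in the strategy.
  let Θ : Ω × Ω₁ × Ω₂ → Q₁ → Q₂ → A₁ → A₂ → ℝ := fun ω =>
    deterministic (fun q => f₁ q (ω.1, ω.2.1)) (fun q => f₂ q (ω.1, ω.2.2))
  have hm : ∀ q₁ q₂ a₁ a₂, MeasurableSet {ω : Ω × Ω₁ × Ω₂ |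
      f₁ q₁ (ω.1, ω.2.1) = a₁ ∧ f₂ q₂ (ω.1, ω.2.2) = a₂} := fun q₁ q₂ a₁ a₂ =>
    ((measurable_fst.prodMk (measurable_fst.comp measurable_snd)) (hf₁ q₁ a₁)).inter
      ((measurable_fst.prodMk (measurable_snd.comp measurable_snd)) (hf₂ q₂ a₂))
  have hΘ : ∀ q₁ q₂ a₁ a₂, (fun ω => Θ ω q₁ q₂ a₁ a₂) =
      Set.indicator {ω : Ω × Ω₁ × Ω₂ |
        f₁ q₁ (ω.1, ω.2.1) = a₁ ∧ f₂ q₂ (ω.1, ω.2.2) = a₂} (fun _ => (1 : ℝ)) := by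
    intro q₁ q₂ a₁ a₂
    funext ω
    simp [Θ, deterministic, Set.indicator_apply]
  have hi : ∀ q₁ q₂ a₁ a₂,
      Integrable (fun ω => Θ ω q₁ q₂ a₁ a₂) (μ.prod (μ₁.prod μ₂)) := by
    intro q₁ q₂ a₁ a₂
    rw [hΘ]
    exact (integrable_const _).indicator (hm _ _ _ _)
  have hθ : θ = fun q₁ q₂ a₁ a₂ => ∫ ω, Θ ω q₁ q₂ a₁ a₂ ∂(μ.prod (μ₁.prod μ₂)) := by
    funext q₁ q₂ a₁ a₂
    rw [h, hΘ, integral_indicator_const _ (hm _ _ _ _)]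
    simp
  obtain ⟨h₁, h₂⟩ := G.winProb_integral _ Θ hi
  rw [hθ, h₁]
  refine (integral_mono h₂ (integrable_const c) fun ω => hc _ _).trans ?_
  simp

end TwoProverGame

/-! ### The question distribution and the unentangled value. -/

namespace PCPGame

variable {Q : ℕ} {A : Type u}

/-- The probability of a position under a uniformly random element of a random triple. -/
noncomputable def posMass (G : PCPGame Q A) (q : Fin Q) : ℝ :=
  ∑ t, G.π t * ∑ j, 1 / 3 * (if t j = q then 1 else 0)

theorem sum_posMass_mul (G : PCPGame Q A) (g : Fin Q → ℝ) :
    ∑ q, G.posMass q * g q = ∑ t, G.π t * ∑ j, 1 / 3 * g (t j) := by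
  simp only [posMass, Finset.sum_mul, mul_assoc, Finset.mul_sum]
  rw [Finset.sum_comm]
  refine Finset.sum_congr rfl fun t _ => ?_
  rw [Finset.sum_comm]
  exact Finset.sum_congr rfl fun j _ => by simp

theorem posMass_mem (G : PCPGame Q A) : G.posMass ∈ stdSimplex ℝ (Fin Q) := by
  constructor
  · exact fun q => Finset.sum_nonneg fun t _ => mul_nonneg (G.π_mem.1 t) (by positivity)
  · have h := G.sum_posMass_mul fun _ => 1
    simpa [G.π_mem.2] using h

/-- Expectations over the questions of the oracularization. -/
theorem sum_dummyDist_mul (G : PCPGame Q A)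
    (g : (Fin 3 → Fin Q) → (Fin 2 → Fin Q) → Fin 2 → ℝ) :
    ∑ t, ∑ p, ∑ r, G.dummyDist (t, p, r) * g t p r =
      ∑ t, G.π t * ∑ j, 1 / 3 * ∑ d, G.posMass d *
        ∑ r, placeProb (t j) d r * g t (secondQuestion (t j) d r) r := by
  refine Finset.sum_congr rfl fun t _ => ?_
  rw [Finset.sum_comm]
  have h : ∀ r, ∑ p, G.dummyDist (t, p, r) * g t p r = ∑ t', ∑ j : Fin 3, ∑ k : Fin 3,
      G.π t * G.π t' * (1 / 3) * (1 / 3) * placeProb (t j) (t' k) r *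
        g t (secondQuestion (t j) (t' k) r) r := by
    intro r
    simp only [dummyDist, Finset.sum_mul, ite_mul, zero_mul]
    rw [Finset.sum_comm]
    refine Finset.sum_congr rfl fun t' _ => ?_
    rw [Finset.sum_comm]
    refine Finset.sum_congr rfl fun j _ => ?_
    rw [Finset.sum_comm]
    refine Finset.sum_congr rfl fun k _ => ?_
    simp
  simp only [h, sum_posMass_mul]
  simp only [Finset.mul_sum]
  rw [Finset.sum_comm]
  conv_rhs => rw [Finset.sum_comm]
  refine Finset.sum_congr rfl fun t' _ => ?_
  rw [Finset.sum_comm]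
  refine Finset.sum_congr rfl fun j _ => ?_
  rw [Finset.sum_comm]
  refine Finset.sum_congr rfl fun k _ => Finset.sum_congr rfl fun r _ => ?_
  ring

theorem secondQuestion_apply (q d : Fin Q) (r : Fin 2) : secondQuestion q d r r = q := by
  fin_cases r <;> simp [secondQuestion]

theorem pos_of_pcpGame (G : PCPGame Q A) : 0 < Q := by
  rcases Nat.eq_zero_or_pos Q with rfl | h
  · have := G.π_mem.2
    simp at this
  · exact h

variable [Fintype A]

open Classical in
theorem winProb_dummyOracularization (G : PCPGame Q A)
    (θ : (Fin 3 → Fin Q) → (Fin 2 → Fin Q) → (Fin 3 → A) → (Fin 2 → A) → ℝ) :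
    G.dummyOracularization.winProb θ = ∑ t, G.π t * ∑ j, 1 / 3 * ∑ d, G.posMass d *
        ∑ r, placeProb (t j) d r * ∑ a, ∑ b, θ t (secondQuestion (t j) d r) a b *
          (if G.R t a ∧ ∀ i, t j = t i → b r = a i then 1 else 0) := by
  have h := G.sum_dummyDist_mul fun t p r => ∑ a, ∑ b, θ t p a b *
    (if G.R t a ∧ ∀ i, p r = t i → b r = a i then 1 else 0)
  simp only [secondQuestion_apply] at h
  rw [← h]
  refine Finset.sum_congr rfl fun t _ => Finset.sum_congr rfl fun p _ =>
    Finset.sum_congr rfl fun r _ => congrArg _ (Finset.sum_congr rfl fun a _ =>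
      Finset.sum_congr rfl fun b _ => congrArg _ ?_)
  exact if_congr Iff.rfl rfl rfl

open Classical in
theorem winProb_eq_sum (G : PCPGame Q A) (θ : (Fin Q → A) → ℝ) :
    G.winProb θ = ∑ x, θ x * ∑ t, G.π t * (if G.R t (fun i => x (t i)) then 1 else 0) := by
  simp only [winProb, Finset.mul_sum]
  rw [Finset.sum_comm]
  exact Finset.sum_congr rfl fun x _ => Finset.sum_congr rfl fun t _ => by ring

theorem winProb_mem_Icc (G : PCPGame Q A) {θ : (Fin Q → A) → ℝ}
    (hθ : θ ∈ stdSimplex ℝ (Fin Q → A)) : G.winProb θ ∈ Set.Icc (0 : ℝ) 1 := by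
  classical
  constructor
  · refine Finset.sum_nonneg fun t _ => mul_nonneg (G.π_mem.1 t) (Finset.sum_nonneg fun x _ =>
      mul_nonneg (hθ.1 x) ?_)
    split_ifs <;> norm_num
  · rw [← G.π_mem.2]
    refine Finset.sum_le_sum fun t _ => mul_le_of_le_one_right (G.π_mem.1 t) ?_
    refine (Finset.sum_le_sum fun x _ => mul_le_of_le_one_right (hθ.1 x) ?_).trans_eq hθ.2
    split_ifs <;> norm_num

theorem winProb_le_value (G : PCPGame Q A) {θ : (Fin Q → A) → ℝ}
    (hθ : θ ∈ stdSimplex ℝ (Fin Q → A)) : G.winProb θ ≤ G.value :=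
  le_csSup ⟨1, by rintro _ ⟨η, hη, rfl⟩; exact (G.winProb_mem_Icc hη).2⟩ ⟨θ, hθ, rfl⟩

theorem value_nonneg (G : PCPGame Q A) : 0 ≤ G.value :=
  Real.sSup_nonneg (by rintro _ ⟨η, hη, rfl⟩; exact (G.winProb_mem_Icc hη).1)

theorem value_le_one (G : PCPGame Q A) : G.value ≤ 1 :=
  Real.sSup_le (by rintro _ ⟨η, hη, rfl⟩; exact (G.winProb_mem_Icc hη).2) zero_le_one

open Classical in
theorem accept_le_value (G : PCPGame Q A) (x : Fin Q → A) :
    ∑ t, G.π t * (if G.R t (fun i => x (t i)) then 1 else 0) ≤ G.value := by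
  have h := G.winProb_le_value (single_mem_stdSimplex ℝ x)
  rw [winProb_eq_sum, Finset.sum_eq_single x] at h
  · simpa using h
  · intro y _ hy
    simp [hy]
  · simp

/-- The place of the real question `q` when the dummy question is `d` and ties go to `r`. -/
def placeOf (q d : Fin Q) (r : Fin 2) : Fin 2 :=
  if q < d then 0 else if d < q then 1 else r

/-- Replaces the place distribution by a fair coin independent of the real question, tossed even
when there is no tie. Dummy question and coin can then be fixed before the triple is drawn. -/
theorem sum_placeProb_mul (q d : Fin Q) (g : Fin 2 → ℝ) :
    ∑ r, placeProb q d r * g r = ∑ r, 1 / 2 * g (placeOf q d r) := by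
  simp only [Fin.sum_univ_two, placeProb, placeOf]
  rcases lt_trichotomy q d with h | h | h
  · simp [h]
    ring
  · simp [h]
  · simp [h, h.not_gt]
    ring

theorem winProb_deterministic_le (G : PCPGame Q A) (f₁ : (Fin 3 → Fin Q) → Fin 3 → A)
    (f₂ : (Fin 2 → Fin Q) → Fin 2 → A) :
    G.dummyOracularization.winProb (TwoProverGame.deterministic f₁ f₂) ≤
      1 - (1 - G.value) / 3 := by
  classical
  rw [winProb_dummyOracularization]
  simp only [TwoProverGame.sum_deterministic_mul, sum_placeProb_mul]
  -- For fixed dummy question and coin, the second prover's answers form one string, to which the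
  -- value of `G` applies.
  let y : Fin Q → Fin 2 → Fin Q → A := fun d r q =>
    f₂ (secondQuestion q d (placeOf q d r)) (placeOf q d r)
  have h₁ : ∀ (t : Fin 3 → Fin Q) (d : Fin Q) (r : Fin 2),
      (∑ j, 1 / 3 * (if G.R t (f₁ t) ∧ ∀ i, t j = t i → y d r (t j) = f₁ t i then (1 : ℝ) else 0)) ≤
        2 / 3 + 1 / 3 * (if G.R t (fun i => y d r (t i)) then 1 else 0) := by
    intro t d r
    by_cases hR : G.R t (fun i => y d r (t i))
    · rw [if_pos hR, ← Finset.mul_sum]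
      have : ∑ j : Fin 3, (if G.R t (f₁ t) ∧ ∀ i, t j = t i → y d r (t j) = f₁ t i
          then (1 : ℝ) else 0) ≤ ∑ _j : Fin 3, 1 :=
        Finset.sum_le_sum fun j _ => by split_ifs <;> norm_num
      simp only [Finset.sum_const, Finset.card_univ, Fintype.card_fin, nsmul_eq_mul] at this
      push_cast at this
      linarith
    · rw [if_neg hR, ← Finset.mul_sum]
      obtain ⟨j, hj⟩ : ∃ j, ¬(G.R t (f₁ t) ∧ ∀ i, t j = t i → y d r (t j) = f₁ t i) := by
        by_contra! hcon
        refine hR ?_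
        have : (fun i => y d r (t i)) = f₁ t := funext fun i => (hcon i).2 i rfl
        rw [this]
        exact (hcon 0).1
      have : ∑ j : Fin 3, (if G.R t (f₁ t) ∧ ∀ i, t j = t i → y d r (t j) = f₁ t i
          then (1 : ℝ) else 0) ≤ ∑ i : Fin 3, if i = j then 0 else 1 :=
        Finset.sum_le_sum fun i _ => by
          by_cases hi : i = j
          · subst hi
            simp [hj]
          · rw [if_neg hi]
            split_ifs <;> norm_num
      have h3 : ∑ i : Fin 3, (if i = j then (0 : ℝ) else 1) = 2 := by
        fin_cases j <;> simp [Fin.sum_univ_three] <;> norm_num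
      linarith
  calc ∑ t, G.π t * ∑ j, 1 / 3 * ∑ d, G.posMass d * ∑ r, 1 / 2 *
        (if G.R t (f₁ t) ∧ ∀ i, t j = t i → y d r (t j) = f₁ t i then (1 : ℝ) else 0)
      = ∑ d, G.posMass d * ∑ r : Fin 2, 1 / 2 * ∑ t, G.π t * ∑ j, 1 / 3 *
        (if G.R t (f₁ t) ∧ ∀ i, t j = t i → y d r (t j) = f₁ t i then (1 : ℝ) else 0) := by
        simp only [Finset.mul_sum]
        rw [Finset.sum_congr rfl fun t _ => Finset.sum_comm, Finset.sum_comm]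
        refine Finset.sum_congr rfl fun d _ => ?_
        rw [Finset.sum_congr rfl fun t _ => Finset.sum_comm, Finset.sum_comm]
        refine Finset.sum_congr rfl fun r _ => Finset.sum_congr rfl fun t _ =>
          Finset.sum_congr rfl fun j _ => ?_
        ring
    _ ≤ ∑ d, G.posMass d * ∑ r : Fin 2, 1 / 2 * (2 / 3 + 1 / 3 * G.value) := by
        refine Finset.sum_le_sum fun d _ => mul_le_mul_of_nonneg_left ?_ (G.posMass_mem.1 d)
        refine Finset.sum_le_sum fun r _ => mul_le_mul_of_nonneg_left ?_ (by norm_num)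
        refine (Finset.sum_le_sum fun t _ =>
          mul_le_mul_of_nonneg_left (h₁ t d r) (G.π_mem.1 t)).trans ?_
        have h₂ := G.accept_le_value (y d r)
        have h₃ : ∑ t, G.π t * (2 / 3 + 1 / 3 * (if G.R t (fun i => y d r (t i)) then 1 else 0)) =
            (∑ t, G.π t) * (2 / 3) +
              1 / 3 * ∑ t, G.π t * (if G.R t (fun i => y d r (t i)) then 1 else 0) := by
          rw [Finset.sum_mul, Finset.mul_sum, ← Finset.sum_add_distrib]
          exact Finset.sum_congr rfl fun t _ => by ring
        rw [h₃, G.π_mem.2]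
        linarith
    _ = 1 - (1 - G.value) / 3 := by
        rw [← Finset.sum_mul, G.posMass_mem.2, Fin.sum_univ_two]
        ring

theorem unentValue_le (G : PCPGame Q A) :
    TwoProverGame.unentValue.{w} G.dummyOracularization ≤ 1 - (1 - G.value) / 3 := by
  -- The bound must also be nonnegative: for an empty alphabet there are no strategies and the real
  -- supremum is 0.
  refine Real.sSup_le ?_ (by linarith [G.value_nonneg])
  rintro _ ⟨θ, hθ, rfl⟩
  exact TwoProverGame.winProb_le_of_isUnentangled _ G.winProb_deterministic_le hθ

theorem value_le_unentValue [Nonempty A] (G : PCPGame Q A) :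
    G.value ≤ TwoProverGame.unentValue.{w} G.dummyOracularization := by
  classical
  have hx : ∀ x : Fin Q → A, ∑ t, G.π t * (if G.R t (fun i => x (t i)) then 1 else 0) ≤
      TwoProverGame.unentValue.{w} G.dummyOracularization := by
    intro x
    refine le_trans (le_of_eq ?_) (le_csSup (a := G.dummyOracularization.winProb
      (TwoProverGame.deterministic (fun t i => x (t i)) (fun p i => x (p i)))) ?_
      ⟨_, TwoProverGame.isUnentangled_deterministic _ _, rfl⟩)
    · rw [winProb_dummyOracularization]
      simp only [TwoProverGame.sum_deterministic_mul, secondQuestion_apply]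
      refine Finset.sum_congr rfl fun t _ => congrArg _ ?_
      have h : ∀ j, (G.R t (fun i => x (t i)) ∧ ∀ i, t j = t i → x (t j) = x (t i)) ↔
          G.R t (fun i => x (t i)) := fun j => and_iff_left fun i hi => congrArg x hi
      simp only [h, ← Finset.sum_mul, sum_placeProb, one_mul, G.posMass_mem.2]
      simp
    · refine ⟨1 - (1 - G.value) / 3, ?_⟩
      rintro _ ⟨θ, hθ, rfl⟩
      exact TwoProverGame.winProb_le_of_isUnentangled _ G.winProb_deterministic_le hθ
  refine csSup_le (Set.Nonempty.image _ ⟨_, single_mem_stdSimplex ℝ (fun _ => Classical.arbitrary A)⟩) ?_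
  rintro _ ⟨θ, hθ, rfl⟩
  rw [winProb_eq_sum]
  refine (Finset.sum_le_sum fun x _ => mul_le_mul_of_nonneg_left (hx x) (hθ.1 x)).trans ?_
  rw [← Finset.sum_mul, hθ.2, one_mul]

end PCPGame

/-! ### Agreement probabilities and mismatch after sequential measurement. -/

section Agreement

variable {A : Type u} {B : Type u₁} {C : Type u₂} [Fintype A] [Fintype B]
  {H : Type v} [NormedAddCommGroup H] [InnerProductSpace ℂ H]

theorem agreeProb_sum_smul {ι : Type*} [Fintype ι] (ψ : H) (E : A → H →L[ℂ] H) (c : ι → ℝ)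
    (F : ι → A → H →L[ℂ] H) :
    agreeProb ψ E (fun a => ∑ i, c i • F i a) = ∑ i, c i * agreeProb ψ E (F i) := by
  have h : ∀ (i : ι) (a : A), (inner ℂ ψ (E a ((c i • F i a) ψ))).re =
      c i * (inner ℂ ψ (E a (F i a ψ))).re := by
    intro i a
    have : (c i • F i a) ψ = (c i : ℂ) • F i a ψ := by simp
    rw [this, map_smul, inner_smul_right, Complex.re_ofReal_mul]
  simp only [agreeProb, sum_apply, map_sum, inner_sum, Complex.re_sum, h, Finset.mul_sum]
  exact Finset.sum_comm

theorem agreeProb_coarsen [Fintype C] [DecidableEq C] (ψ : H) (E : A → H →L[ℂ] H) (F : B → H →L[ℂ] H)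
    (f : A → C) (g : B → C) :
    agreeProb ψ (coarsen f E) (coarsen g F) =
      ∑ a, ∑ b, (inner ℂ ψ (E a (F b ψ))).re * (if g b = f a then 1 else 0) := by
  have h : ∀ (c : C) (a : A) (b : B),
      (inner ℂ ψ ((if f a = c then E a else 0) ((if g b = c then F b else 0) ψ))).re =
        if f a = c then (if g b = f a then (inner ℂ ψ (E a (F b ψ))).re else 0) else 0 := by
    intro c a b
    split_ifs <;> simp_all
  simp only [agreeProb, coarsen, sum_apply, map_sum, inner_sum, Complex.re_sum, h]
  rw [Finset.sum_congr rfl fun c _ => Finset.sum_comm, Finset.sum_comm]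
  refine Finset.sum_congr rfl fun a _ => ?_
  rw [Finset.sum_comm]
  refine Finset.sum_congr rfl fun b _ => ?_
  simp

theorem Commute.coarsen [DecidableEq C] {T : H →L[ℂ] H} {E : A → H →L[ℂ] H}
    (h : ∀ a, Commute T (E a)) (f : A → C) (c : C) : Commute T (coarsen f E c) := by
  refine Commute.sum_right _ _ _ fun a _ => ?_
  split_ifs
  · exact h a
  · exact Commute.zero_right T

theorem commute_sum_smul {ι : Type*} [Fintype ι] {T : H →L[ℂ] H} {E : ι → H →L[ℂ] H}
    (h : ∀ i, Commute T (E i)) (c : ι → ℝ) : Commute T (∑ i, c i • E i) :=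
  Commute.sum_right _ _ _ fun i _ => (h i).smul_right (c i)

variable [CompleteSpace H]

theorem agreeProb_le_one {E F : A → H →L[ℂ] H} (hE : IsPOVM E) (hF : IsPOVM F)
    (h : ∀ a b, Commute (E a) (F b)) {ψ : H} (hψ : ‖ψ‖ = 1) : agreeProb ψ E F ≤ 1 := by
  have := (sq_nonneg _).trans (famNorm_sqrt_sub_sqrt_sq_le hE hF h hψ)
  linarith

theorem norm_sqrt_sqrt_apply_sq {S T : H →L[ℂ] H} (hS : 0 ≤ S) (hT : 0 ≤ T) (h : Commute S T)
    (ψ : H) : ‖CFC.sqrt S (CFC.sqrt T ψ)‖ ^ 2 = (inner ℂ ψ (S (T ψ))).re := by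
  rw [norm_sqrt_apply_sq hS, inner_sqrt_apply, (commute_sqrt h).apply_apply,
    sqrt_apply_sqrt_apply hT, ← h.apply_apply, h.apply_apply]

variable {Q : Type*} {K : Q → A → H →L[ℂ] H}

/-- No-signalling: √T passes through the Kraus operators, which preserve the total squared norm of
√T ψ. -/
theorem sum_inner_seqOp (hK : ∀ q, IsKraus (K q)) {T : H →L[ℂ] H} (hT : 0 ≤ T)
    (h : ∀ q a, Commute T (K q a)) (n : ℕ) (e : Fin n → Q) (ψ : H) :
    ∑ x, (inner ℂ (seqOp K n e x ψ) (T (seqOp K n e x ψ))).re = (inner ℂ ψ (T ψ)).re := by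
  have h' : ∀ q a, Commute (CFC.sqrt T) (K q a) := fun q a => (commute_sqrt (h q a).symm).symm
  simp only [← norm_sqrt_apply_sq hT, (commute_seqOp h' n e _).apply_apply]
  exact sum_seqOp hK n e _

/-- The mismatch between the outcome in place `m` of a sequence of measurements and the outcome of
a measurement `E` on the other side is at most what it is without the other measurements of the
sequence, up to the disturbance that these cause. -/
theorem mismatch_seqOp_le [DecidableEq A] {F : Q → A → H →L[ℂ] H} (hF : ∀ q, IsPOVM (F q))
    {E : A → H →L[ℂ] H} (hE : IsPOVM E) (h : ∀ a q b, Commute (E a) (F q b)) {ψ : H}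
    (hψ : ‖ψ‖ = 1) (n : ℕ) (e : Fin n → Q) (m : Fin n) :
    let K := fun q a => CFC.sqrt (F q a)
    ∑ x, ∑ a, (if x m = a then 0
      else (inner ℂ (seqOp K n e x ψ) (E a (seqOp K n e x ψ))).re) ≤
      1 - agreeProb ψ E (F (e m)) + 2 * famNorm ((fun x => seqOp K n e x ψ) -
        fun x => skipOp K n e x m (K (e m) (x m) ψ)) := by
  intro K
  have hK : ∀ q, IsKraus (K q) := fun q => (hF q).isKraus
  have hEK : ∀ a q b, Commute (CFC.sqrt (E a)) (K q b) := fun a q b =>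
    commute_sqrt (commute_sqrt (h a q b).symm).symm
  -- Measures `E` and keeps only mismatched outcomes. It is a linear contraction, so its squared
  -- norms at V and W, the mismatches with place `m` measured in turn and first, are close.
  let Φ : ((Fin n → A) → H) → (Fin n → A) × A → H := fun v p =>
    if p.1 m = p.2 then 0 else CFC.sqrt (E p.2) (v p.1)
  have hΦ : ∀ v, famNorm (Φ v) ≤ famNorm v := by
    intro v
    refine Real.sqrt_le_sqrt ?_
    rw [Fintype.sum_prod_type]
    refine Finset.sum_le_sum fun x _ => ?_
    rw [← hE.isKraus (v x)]
    refine Finset.sum_le_sum fun a _ => ?_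
    by_cases hx : x m = a <;> simp [Φ, hx]
  have hΦ' : ∀ v w, Φ v - Φ w = Φ (v - w) := by
    intro v w
    funext p
    by_cases hp : p.1 m = p.2 <;> simp [Φ, hp]
  set V : (Fin n → A) → H := fun x => seqOp K n e x ψ with hV
  set W : (Fin n → A) → H := fun x => skipOp K n e x m (K (e m) (x m) ψ) with hW
  have hV1 : famNorm V = 1 := by
    rw [famNorm, hV, sum_seqOp hK, hψ]
    simp
  have hW1 : famNorm W = 1 := by
    rw [famNorm, hW, sum_skipOp hK n e m fun b => K (e m) b ψ, hK (e m) ψ, hψ]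
    simp
  have hpV : ∑ x, ∑ a, (if x m = a then 0
      else (inner ℂ (seqOp K n e x ψ) (E a (seqOp K n e x ψ))).re) = famNorm (Φ V) ^ 2 := by
    rw [famNorm_sq, Fintype.sum_prod_type]
    refine Finset.sum_congr rfl fun x _ => Finset.sum_congr rfl fun a _ => ?_
    by_cases hx : x m = a <;> simp [Φ, hx, V, norm_sqrt_apply_sq (hE.nonneg a)]
  have hpW : famNorm (Φ W) ^ 2 = 1 - agreeProb ψ E (F (e m)) := by
    rw [famNorm_sq, Fintype.sum_prod_type, Finset.sum_comm]
    have h₁ : ∀ a x, ‖Φ W (x, a)‖ ^ 2 = ‖skipOp K n e x m ((fun b =>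
        if b = a then 0 else CFC.sqrt (E a) (K (e m) b ψ)) (x m))‖ ^ 2 := by
      intro a x
      by_cases hx : x m = a
      · simp [Φ, hx]
      · simp only [Φ, hx, W, if_false, (commute_skipOp (hEK a) n e x m).apply_apply]
    have h₂ : ∀ a b, ‖if b = a then 0 else CFC.sqrt (E a) (K (e m) b ψ)‖ ^ 2 =
        ‖CFC.sqrt (E a) (K (e m) b ψ)‖ ^ 2 -
          if b = a then (inner ℂ ψ (E a (F (e m) a ψ))).re else 0 := by
      intro a b
      by_cases hb : b = a
      · simp [hb, K, norm_sqrt_sqrt_apply_sq (hE.nonneg a) ((hF (e m)).nonneg a) (h a (e m) a)]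
      · simp [hb]
    have h₃ : ∀ a, ∑ x, ‖Φ W (x, a)‖ ^ 2 =
        ∑ b, ‖if b = a then 0 else CFC.sqrt (E a) (K (e m) b ψ)‖ ^ 2 := fun a =>
      (Finset.sum_congr rfl fun x _ => h₁ a x).trans (sum_skipOp hK n e m fun b =>
        if b = a then 0 else CFC.sqrt (E a) (K (e m) b ψ))
    simp only [h₃, h₂, Finset.sum_sub_distrib, Finset.sum_ite_eq', Finset.mem_univ, if_true]
    rw [Finset.sum_comm, Finset.sum_congr rfl fun b _ => hE.isKraus (K (e m) b ψ), hK (e m) ψ, hψ,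
      one_pow]
    rfl
  rw [hpV, ← hpW]
  have h₁ : famNorm (Φ V) ≤ famNorm (Φ W) + famNorm (V - W) := by
    have := famNorm_add_le (Φ V - Φ W) (Φ W)
    rw [sub_add_cancel, hΦ'] at this
    linarith [hΦ (V - W)]
  have h₂ := hΦ V
  have h₃ := hΦ W
  have h₄ := famNorm_nonneg (Φ V)
  have h₅ := famNorm_nonneg (Φ W)
  have h₆ := famNorm_nonneg (V - W)
  rw [hV1] at h₂
  rw [hW1] at h₃
  -- With a = ‖Φ V‖, b = ‖Φ W‖ and a - b ≤ ‖V - W‖: a² - b² ≤ ‖V - W‖ (a + b) ≤ 2‖V - W‖.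
  nlinarith [mul_nonneg h₆ (by linarith : 0 ≤ 2 - famNorm (Φ V) - famNorm (Φ W)),
    mul_nonneg (by linarith : 0 ≤ famNorm (Φ W) + famNorm (V - W) - famNorm (Φ V))
      (by linarith : 0 ≤ famNorm (Φ V) + famNorm (Φ W))]

end Agreement

/-! ### Ordering the positions by weight. -/

/-- Sums over earlier positions, in the order of decreasing weight, are bounded by the root mean
square over all pairs. -/
theorem sum_mul_sum_lt_le {Q : ℕ} {μ : Fin Q → ℝ} (hμ : ∀ q, 0 ≤ μ q) (σ : Equiv.Perm (Fin Q))
    (hσ : Antitone (μ ∘ σ)) {h : Fin Q → Fin Q → ℝ} (hh : ∀ q q', 0 ≤ h q q') :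
    ∑ m, μ (σ m) * ∑ i, (if i < m then h (σ m) (σ i) else 0) ≤
      Q * √(∑ q, ∑ q', μ q * μ q' * h q q' ^ 2) := by
  have h₁ : ∑ m, μ (σ m) * ∑ i, (if i < m then h (σ m) (σ i) else 0) ≤
      ∑ m, ∑ i, √(μ (σ m) * μ (σ i)) * h (σ m) (σ i) := by
    refine Finset.sum_le_sum fun m _ => ?_
    rw [Finset.mul_sum]
    refine Finset.sum_le_sum fun i _ => ?_
    -- The earlier position has the larger weight, so μ(σ m)² ≤ μ(σ m) μ(σ i).
    split_ifs with him
    · refine mul_le_mul_of_nonneg_right (Real.le_sqrt_of_sq_le ?_) (hh _ _)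
      rw [sq]
      exact mul_le_mul_of_nonneg_left (hσ him.le) (hμ _)
    · rw [mul_zero]
      exact mul_nonneg (Real.sqrt_nonneg _) (hh _ _)
  have h₂ : ∑ m, ∑ i, √(μ (σ m) * μ (σ i)) * h (σ m) (σ i) =
      ∑ p : Fin Q × Fin Q, √(μ p.1 * μ p.2) * h p.1 p.2 := by
    rw [Fintype.sum_prod_type]
    exact (Finset.sum_congr rfl fun m _ => Equiv.sum_comp σ fun q' =>
      √(μ (σ m) * μ q') * h (σ m) q').trans
        (Equiv.sum_comp σ fun q => ∑ q', √(μ q * μ q') * h q q')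
  -- Cauchy–Schwarz over Q² ordered pairs is the source of the factor Q.
  have h₃ := sq_sum_le_card_mul_sum_sq (s := (Finset.univ : Finset (Fin Q × Fin Q)))
    (f := fun p => √(μ p.1 * μ p.2) * h p.1 p.2)
  have h₄ : ∑ p : Fin Q × Fin Q, (√(μ p.1 * μ p.2) * h p.1 p.2) ^ 2 =
      ∑ q, ∑ q', μ q * μ q' * h q q' ^ 2 := by
    rw [Fintype.sum_prod_type]
    refine Finset.sum_congr rfl fun q _ => Finset.sum_congr rfl fun q' _ => ?_
    rw [mul_pow, Real.sq_sqrt (mul_nonneg (hμ _) (hμ _))]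
  rw [h₄, Finset.card_univ, Fintype.card_prod, Fintype.card_fin] at h₃
  refine h₁.trans (h₂.trans_le ?_)
  refine (Real.le_sqrt_of_sq_le h₃).trans_eq ?_
  rw [Nat.cast_mul, Real.sqrt_mul (by positivity), Real.sqrt_mul_self (by positivity)]

/-! ### Reading a string off the second prover's measurements. -/

namespace PCPGame

variable {Q : ℕ} {A : Type u} [Fintype A]
  {H : Type v} [NormedAddCommGroup H] [InnerProductSpace ℂ H]

open Classical in
/-- The answer of the first prover to position `t j`, as a measurement. -/
noncomputable def fstMarginal (M : (Fin 3 → Fin Q) → (Fin 3 → A) → H →L[ℂ] H)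
    (t : Fin 3 → Fin Q) (j : Fin 3) : A → H →L[ℂ] H :=
  coarsen (fun a => a j) (M t)

open Classical in
/-- The answer of the second prover to the real question `q` when the dummy question is `d`. -/
noncomputable def sndMarginal (N : (Fin 2 → Fin Q) → (Fin 2 → A) → H →L[ℂ] H) (q d : Fin Q) :
    A → H →L[ℂ] H :=
  fun a => ∑ r, placeProb q d r • coarsen (fun b => b r) (N (secondQuestion q d r)) a

/-- The answer of the second prover to the real question `q` when the dummy question is random. -/
noncomputable def sndAverage (G : PCPGame Q A) (N : (Fin 2 → Fin Q) → (Fin 2 → A) → H →L[ℂ] H)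
    (q : Fin Q) : A → H →L[ℂ] H :=
  fun a => ∑ d, G.posMass d • sndMarginal N q d a

/-- The winning probability in the oracularization of provers that measure a pure state. -/
noncomputable def pureWinProb (G : PCPGame Q A) (M : (Fin 3 → Fin Q) → (Fin 3 → A) → H →L[ℂ] H)
    (N : (Fin 2 → Fin Q) → (Fin 2 → A) → H →L[ℂ] H) (ψ : H) : ℝ :=
  G.dummyOracularization.winProb fun t p a b => (inner ℂ ψ (M t a (N p b ψ))).re

variable {G : PCPGame Q A} {M : (Fin 3 → Fin Q) → (Fin 3 → A) → H →L[ℂ] H}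
  {N : (Fin 2 → Fin Q) → (Fin 2 → A) → H →L[ℂ] H}

theorem isPOVM_fstMarginal [CompleteSpace H] (hM : ∀ t, IsPOVM (M t)) (t : Fin 3 → Fin Q) (j : Fin 3) :
    IsPOVM (fstMarginal M t j) := by
  classical exact (hM t).coarsen _

theorem isPOVM_sndMarginal [CompleteSpace H] (hN : ∀ p, IsPOVM (N p)) (q d : Fin Q) :
    IsPOVM (sndMarginal N q d) :=
  isPOVM_sum_smul ⟨placeProb_nonneg q d, sum_placeProb q d⟩ fun _ => by
    classical exact (hN _).coarsen _

theorem isPOVM_sndAverage [CompleteSpace H] (G : PCPGame Q A) (hN : ∀ p, IsPOVM (N p)) (q : Fin Q) :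
    IsPOVM (G.sndAverage N q) :=
  isPOVM_sum_smul G.posMass_mem fun d => isPOVM_sndMarginal hN q d

theorem commute_sndMarginal {T : H →L[ℂ] H} (h : ∀ p b, Commute T (N p b)) (q d : Fin Q) (a : A) :
    Commute T (sndMarginal N q d a) :=
  commute_sum_smul (fun _ => by classical exact Commute.coarsen (h _) _ _) _

theorem commute_sndAverage (G : PCPGame Q A) {T : H →L[ℂ] H} (h : ∀ p b, Commute T (N p b))
    (q : Fin Q) (a : A) : Commute T (G.sndAverage N q a) :=
  commute_sum_smul (fun d => commute_sndMarginal h q d a) _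

theorem commute_fstMarginal {T : H →L[ℂ] H} (h : ∀ t a, Commute (M t a) T) (t : Fin 3 → Fin Q)
    (j : Fin 3) (a : A) : Commute (fstMarginal M t j a) T := by
  classical exact (Commute.coarsen (fun a => (h t a).symm) _ _).symm

theorem agreeProb_sndAverage (ψ : H) (E : A → H →L[ℂ] H) (q : Fin Q) :
    agreeProb ψ E (G.sndAverage N q) = ∑ d, G.posMass d * agreeProb ψ E (sndMarginal N q d) :=
  agreeProb_sum_smul ψ E G.posMass fun d => sndMarginal N q d

theorem inner_mul_nonneg [CompleteSpace H] (hM : ∀ t, IsPOVM (M t)) (hN : ∀ p, IsPOVM (N p))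
    (hMN : ∀ t p a b, Commute (M t a) (N p b)) (ψ : H) (t p a b) :
    0 ≤ (inner ℂ ψ (M t a (N p b ψ))).re :=
  re_inner_nonneg (Commute.mul_nonneg ((hM t).nonneg a) ((hN p).nonneg b) (hMN t p a b)) ψ

-- Winning requires acceptance of the first prover's answers; summing over the second prover's
-- answers removes `N`.
open Classical in
theorem pureWinProb_le_accept [CompleteSpace H] (hM : ∀ t, IsPOVM (M t)) (hN : ∀ p, IsPOVM (N p))
    (hMN : ∀ t p a b, Commute (M t a) (N p b)) (ψ : H) :
    G.pureWinProb M N ψ ≤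
      ∑ t, G.π t * ∑ a, (inner ℂ ψ (M t a ψ)).re * (if G.R t a then 1 else 0) := by
  rw [pureWinProb, winProb_dummyOracularization]
  refine Finset.sum_le_sum fun t _ => mul_le_mul_of_nonneg_left ?_ (G.π_mem.1 t)
  set c := ∑ a, (inner ℂ ψ (M t a ψ)).re * (if G.R t a then (1 : ℝ) else 0) with hc
  have h : ∀ p r j, ∑ a, ∑ b, (inner ℂ ψ (M t a (N p b ψ))).re *
      (if G.R t a ∧ ∀ i, t j = t i → b r = a i then (1 : ℝ) else 0) ≤ c := by
    intro p r j
    refine Finset.sum_le_sum fun a _ => ?_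
    have h₁ : (inner ℂ ψ (M t a ψ)).re = ∑ b, (inner ℂ ψ (M t a (N p b ψ))).re := by
      rw [← Complex.re_sum, ← inner_sum, ← map_sum, ← sum_apply, (hN p).2, one_apply_eq_self]
    rw [h₁, Finset.sum_mul]
    refine Finset.sum_le_sum fun b _ => mul_le_mul_of_nonneg_left ?_
      (inner_mul_nonneg hM hN hMN ψ t p a b)
    by_cases hR : G.R t a <;> simp [hR]
    split_ifs <;> norm_num
  calc _ ≤ ∑ j : Fin 3, 1 / 3 * ∑ d, G.posMass d * ∑ r, placeProb (t j) d r * c := by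
        refine Finset.sum_le_sum fun j _ => mul_le_mul_of_nonneg_left ?_ (by norm_num)
        refine Finset.sum_le_sum fun d _ => mul_le_mul_of_nonneg_left ?_ (G.posMass_mem.1 d)
        exact Finset.sum_le_sum fun r _ =>
          mul_le_mul_of_nonneg_left (h _ _ _) (placeProb_nonneg _ _ _)
    _ = c := by
        simp only [← Finset.sum_mul, sum_placeProb, one_mul, G.posMass_mem.2]
        simp

/-- Acceptance is dropped and only the consistency test at the sampled index `j` is kept. -/
theorem pureWinProb_le_agree [CompleteSpace H] (hM : ∀ t, IsPOVM (M t)) (hN : ∀ p, IsPOVM (N p))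
    (hMN : ∀ t p a b, Commute (M t a) (N p b)) (ψ : H) :
    G.pureWinProb M N ψ ≤
      ∑ t, G.π t * ∑ j, 1 / 3 * agreeProb ψ (fstMarginal M t j) (G.sndAverage N (t j)) := by
  classical
  rw [pureWinProb, winProb_dummyOracularization]
  refine Finset.sum_le_sum fun t _ => mul_le_mul_of_nonneg_left ?_ (G.π_mem.1 t)
  refine Finset.sum_le_sum fun j _ => mul_le_mul_of_nonneg_left ?_ (by norm_num)
  rw [agreeProb_sndAverage]
  refine Finset.sum_le_sum fun d _ => mul_le_mul_of_nonneg_left ?_ (G.posMass_mem.1 d)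
  unfold sndMarginal
  rw [agreeProb_sum_smul]
  refine Finset.sum_le_sum fun r _ => mul_le_mul_of_nonneg_left ?_ (placeProb_nonneg _ _ _)
  unfold fstMarginal
  rw [agreeProb_coarsen]
  refine Finset.sum_le_sum fun a _ => Finset.sum_le_sum fun b _ =>
    mul_le_mul_of_nonneg_left ?_ (inner_mul_nonneg hM hN hMN ψ _ _ a b)
  by_cases h : b r = a j
  · rw [if_pos h]
    split_ifs <;> norm_num
  · rw [if_neg h, if_neg fun h' => h (h'.2 j rfl)]

variable [CompleteSpace H]

/-- The Kraus operators by which the string is read off position by position. -/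
noncomputable def readKraus (G : PCPGame Q A) (N : (Fin 2 → Fin Q) → (Fin 2 → A) → H →L[ℂ] H)
    (q : Fin Q) (a : A) : H →L[ℂ] H := CFC.sqrt (G.sndAverage N q a)

/-- The disturbance of the answer in place `m` of the string caused by the earlier ones. -/
noncomputable def disturbance (G : PCPGame Q A)
    (N : (Fin 2 → Fin Q) → (Fin 2 → A) → H →L[ℂ] H) (σ : Equiv.Perm (Fin Q)) (ψ : H)
    (m : Fin Q) : ℝ :=
  famNorm ((fun x => seqOp (G.readKraus N) Q σ x ψ) -
    fun x => skipOp (G.readKraus N) Q σ x m (G.readKraus N (σ m) (x m) ψ))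

open Classical in
/-- The string read off by measuring the positions one by one is accepted nearly as often as the
answers of the first prover, up to disagreement and disturbance. -/
theorem one_sub_accept_le (hM : ∀ t, IsPOVM (M t)) (hN : ∀ p, IsPOVM (N p))
    (hMN : ∀ t p a b, Commute (M t a) (N p b)) {ψ : H} (hψ : ‖ψ‖ = 1) (σ : Equiv.Perm (Fin Q))
    (t : Fin 3 → Fin Q) :
    1 - ∑ x, ‖seqOp (G.readKraus N) Q σ x ψ‖ ^ 2 *
        (if G.R t (fun i => x (σ.symm (t i))) then 1 else 0) ≤
      (1 - ∑ a, (inner ℂ ψ (M t a ψ)).re * (if G.R t a then 1 else 0)) +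
        ∑ j, (1 - agreeProb ψ (fstMarginal M t j) (G.sndAverage N (t j)) +
          2 * G.disturbance N σ ψ (σ.symm (t j))) := by
  have hF := isPOVM_sndAverage G hN
  have hK : ∀ q, IsKraus (G.readKraus N q) := fun q => (hF q).isKraus
  have hMF : ∀ t a q b, Commute (M t a) (G.sndAverage N q b) := fun t a q b =>
    commute_sndAverage G (fun p b => hMN t p a b) q b
  have hMK : ∀ t a q b, Commute (M t a) (G.readKraus N q b) := fun t a q b =>
    commute_sqrt (hMF t a q b)
  set V := fun x => seqOp (G.readKraus N) Q σ x ψ with hV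
  -- The joint law of the string and the first prover's answers; by commutation its second marginal
  -- is the law of those answers on ψ.
  set P : (Fin Q → A) → (Fin 3 → A) → ℝ := fun x a => (inner ℂ (V x) (M t a (V x))).re with hP
  have hP₀ : ∀ x a, 0 ≤ P x a := fun x a => re_inner_nonneg ((hM t).nonneg a) _
  have hPx : ∀ x, ∑ a, P x a = ‖V x‖ ^ 2 := by
    intro x
    rw [hP, ← Complex.re_sum, ← inner_sum, ← sum_apply, (hM t).2, one_apply_eq_self,
      inner_self_eq_norm_sq_to_K]
    norm_cast
  have hPa : ∀ a, ∑ x, P x a = (inner ℂ ψ (M t a ψ)).re := fun a =>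
    sum_inner_seqOp hK ((hM t).nonneg a) (fun q b => hMK t a q b) Q σ ψ
  have hV1 : ∑ x, ‖V x‖ ^ 2 = 1 := by rw [hV, sum_seqOp hK, hψ, one_pow]
  have hψ1 : ∑ a, (inner ℂ ψ (M t a ψ)).re = 1 := by
    rw [← hV1, ← Finset.sum_congr rfl fun a _ => hPa a, Finset.sum_comm]
    exact Finset.sum_congr rfl fun x _ => hPx x
  have h₁ : 1 - ∑ x, ‖V x‖ ^ 2 * (if G.R t (fun i => x (σ.symm (t i))) then 1 else 0) =
      ∑ x, ∑ a, P x a * (if G.R t (fun i => x (σ.symm (t i))) then 0 else 1) := by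
    rw [← congrArg (· - _) hV1, ← Finset.sum_sub_distrib]
    refine Finset.sum_congr rfl fun x _ => ?_
    rw [← Finset.sum_mul, hPx]
    split_ifs <;> ring
  have h₂ : ∀ j, ∑ x, ∑ a, P x a * (if x (σ.symm (t j)) = a j then 0 else 1) ≤
      1 - agreeProb ψ (fstMarginal M t j) (G.sndAverage N (t j)) +
        2 * G.disturbance N σ ψ (σ.symm (t j)) := by
    intro j
    have h := mismatch_seqOp_le hF (isPOVM_fstMarginal hM t j)
      (fun a q b => commute_fstMarginal (fun t a => hMF t a q b) t j a) hψ Q σ (σ.symm (t j))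
    simp only [Equiv.apply_symm_apply] at h
    refine le_trans (le_of_eq ?_) (h.trans_eq ?_)
    · refine Finset.sum_congr rfl fun x _ => ?_
      have h' : ∀ a, (inner ℂ (V x) (fstMarginal M t j a (V x))).re =
          ∑ b : Fin 3 → A, if b j = a then P x b else 0 := by
        intro a
        simp only [fstMarginal, coarsen, sum_apply, inner_sum, Complex.re_sum]
        refine Finset.sum_congr rfl fun b _ => ?_
        split_ifs <;> simp [P]
      have h'' : ∀ a, (if x (σ.symm (t j)) = a then 0
          else (inner ℂ (V x) (fstMarginal M t j a (V x))).re) =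
          ∑ b : Fin 3 → A, if b j = a then
            P x b * (if x (σ.symm (t j)) = b j then 0 else 1) else 0 := by
        intro a
        rw [h']
        by_cases ha : x (σ.symm (t j)) = a
        · rw [if_pos ha]
          refine (Finset.sum_eq_zero fun b _ => ?_).symm
          by_cases hb : b j = a <;> simp [ha, hb]
        · rw [if_neg ha]
          refine Finset.sum_congr rfl fun b _ => ?_
          by_cases hb : b j = a <;> simp [ha, hb]
      refine Eq.symm ((Finset.sum_congr rfl fun a _ => h'' a).trans ?_)
      rw [Finset.sum_comm]
      exact Finset.sum_congr rfl fun b _ => by simp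
    · simp only [disturbance, Equiv.apply_symm_apply]
      rfl
  calc _ = ∑ x, ∑ a, P x a * (if G.R t (fun i => x (σ.symm (t i))) then 0 else 1) := h₁
    _ ≤ ∑ x, ∑ a, (P x a * (1 - if G.R t a then 1 else 0) +
        ∑ j, P x a * (if x (σ.symm (t j)) = a j then 0 else 1)) := by
        -- Union bound: if the string is rejected, the answers `a` are rejected or differ from it at
        -- some `j`.
        refine Finset.sum_le_sum fun x _ => Finset.sum_le_sum fun a _ => ?_
        rw [← Finset.mul_sum, ← mul_add]
        refine mul_le_mul_of_nonneg_left ?_ (hP₀ x a)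
        have hnn : ∀ j ∈ (Finset.univ : Finset (Fin 3)),
            (0 : ℝ) ≤ if x (σ.symm (t j)) = a j then 0 else 1 := fun j _ => by
          split_ifs <;> norm_num
        by_cases hR : G.R t a
        · rw [if_pos hR, sub_self, zero_add]
          by_cases hx : ∀ j, x (σ.symm (t j)) = a j
          · rw [if_pos (by rwa [funext hx])]
            exact Finset.sum_nonneg hnn
          · push Not at hx
            obtain ⟨j, hj⟩ := hx
            refine le_trans ?_ (Finset.single_le_sum hnn (Finset.mem_univ j))
            rw [if_neg hj]
            split_ifs <;> norm_num
        · rw [if_neg hR, sub_zero]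
          refine le_add_of_le_of_nonneg ?_ (Finset.sum_nonneg hnn)
          split_ifs <;> norm_num
    _ = (1 - ∑ a, (inner ℂ ψ (M t a ψ)).re * (if G.R t a then 1 else 0)) +
        ∑ j, ∑ x, ∑ a, P x a * (if x (σ.symm (t j)) = a j then 0 else 1) := by
        simp only [Finset.sum_add_distrib]
        congr 1
        · rw [Finset.sum_comm, ← congrArg (· - _) hψ1, ← Finset.sum_sub_distrib]
          refine Finset.sum_congr rfl fun a _ => ?_
          rw [← Finset.sum_mul, hPa]
          ring
        · rw [Finset.sum_congr rfl fun x _ => Finset.sum_comm, Finset.sum_comm]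
    _ ≤ _ := add_le_add le_rfl (Finset.sum_le_sum fun j _ => h₂ j)

/-- The value of the game bounds the losing probability from below through the disturbance. -/
theorem one_sub_value_le (hM : ∀ t, IsPOVM (M t)) (hN : ∀ p, IsPOVM (N p))
    (hMN : ∀ t p a b, Commute (M t a) (N p b)) {ψ : H} (hψ : ‖ψ‖ = 1) (σ : Equiv.Perm (Fin Q)) :
    1 - G.value ≤ 4 * (1 - G.pureWinProb M N ψ) +
      6 * ∑ m, G.posMass (σ m) * G.disturbance N σ ψ m := by
  classical
  have hK : ∀ q, IsKraus (G.readKraus N q) := fun q => (isPOVM_sndAverage G hN q).isKraus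
  let V := fun x => seqOp (G.readKraus N) Q σ x ψ
  -- Precomposition with `σ` passes from strings indexed by position to outcomes indexed by place in
  -- the measuring order.
  let ρ : (Fin Q → A) ≃ (Fin Q → A) := σ.symm.arrowCongr (Equiv.refl A)
  have hρ : ∀ x q, ρ x (σ.symm q) = x q := fun x q => by simp [ρ]
  have hθ : (fun x => ‖V (ρ x)‖ ^ 2) ∈ stdSimplex ℝ (Fin Q → A) := by
    refine ⟨fun x => sq_nonneg _, ?_⟩
    rw [Equiv.sum_comp ρ fun y => ‖V y‖ ^ 2, sum_seqOp hK, hψ, one_pow]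
  have h₁ := G.winProb_le_value hθ
  have h₂ : G.winProb (fun x => ‖V (ρ x)‖ ^ 2) = ∑ t, G.π t * ∑ x, ‖V x‖ ^ 2 *
      (if G.R t (fun i => x (σ.symm (t i))) then 1 else 0) := by
    refine Finset.sum_congr rfl fun t _ => congrArg _ ?_
    refine Eq.trans ?_ (Equiv.sum_comp ρ fun y => ‖V y‖ ^ 2 *
      (if G.R t (fun i => y (σ.symm (t i))) then 1 else 0))
    simp only [hρ]
  have h₃ : 1 - G.winProb (fun x => ‖V (ρ x)‖ ^ 2) ≤ ∑ t, G.π t *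
      ((1 - ∑ a, (inner ℂ ψ (M t a ψ)).re * (if G.R t a then 1 else 0)) +
        ∑ j, (1 - agreeProb ψ (fstMarginal M t j) (G.sndAverage N (t j)) +
          2 * G.disturbance N σ ψ (σ.symm (t j)))) := by
    have := Finset.sum_le_sum fun t (_ : t ∈ Finset.univ) =>
      mul_le_mul_of_nonneg_left (one_sub_accept_le (G := G) hM hN hMN hψ σ t) (G.π_mem.1 t)
    refine le_trans (le_of_eq ?_) this
    rw [h₂, ← G.π_mem.2, ← Finset.sum_sub_distrib]
    refine Finset.sum_congr rfl fun t _ => ?_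
    rw [G.π_mem.2]
    ring
  -- The sum over `j` is three times a uniform average. Acceptance and disagreement contribute 1 + 3
  -- = 4 losing probabilities, and the disturbance gets 3 · 2 = 6.
  have h₄ : ∑ t, G.π t *
      ((1 - ∑ a, (inner ℂ ψ (M t a ψ)).re * (if G.R t a then 1 else 0)) +
        ∑ j, (1 - agreeProb ψ (fstMarginal M t j) (G.sndAverage N (t j)) +
          2 * G.disturbance N σ ψ (σ.symm (t j)))) =
      4 * ∑ t, G.π t - ∑ t, G.π t * ∑ a, (inner ℂ ψ (M t a ψ)).re * (if G.R t a then 1 else 0) -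
        3 * ∑ t, G.π t * ∑ j, 1 / 3 * agreeProb ψ (fstMarginal M t j) (G.sndAverage N (t j)) +
        6 * ∑ t, G.π t * ∑ j, 1 / 3 * G.disturbance N σ ψ (σ.symm (t j)) := by
    simp only [Finset.mul_sum (a := (3 : ℝ)), Finset.mul_sum (a := (4 : ℝ)),
      Finset.mul_sum (a := (6 : ℝ)), ← Finset.sum_sub_distrib, ← Finset.sum_add_distrib]
    refine Finset.sum_congr rfl fun t _ => ?_
    simp only [Fin.sum_univ_three]
    ring
  have h₅ := pureWinProb_le_accept (G := G) hM hN hMN ψ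
  have h₆ := pureWinProb_le_agree (G := G) hM hN hMN ψ
  have h₇ := G.sum_posMass_mul fun q => G.disturbance N σ ψ (σ.symm q)
  rw [← Equiv.sum_comp σ] at h₇
  simp only [Equiv.symm_apply_apply] at h₇
  rw [h₄, G.π_mem.2, ← h₇] at h₃
  linarith

end PCPGame

/-! ### Near-commutation and the commuting-operator bound. -/

namespace PCPGame

variable {Q : ℕ} {A : Type u} [Fintype A]
  {H : Type v} [NormedAddCommGroup H] [InnerProductSpace ℂ H]
  {G : PCPGame Q A} {M : (Fin 3 → Fin Q) → (Fin 3 → A) → H →L[ℂ] H}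
  {N : (Fin 2 → Fin Q) → (Fin 2 → A) → H →L[ℂ] H}

open Classical in
theorem sndMarginal_of_lt (N : (Fin 2 → Fin Q) → (Fin 2 → A) → H →L[ℂ] H) {q d : Fin Q}
    (h : q < d) : sndMarginal N q d = coarsen (fun b => b 0) (N ![q, d]) := by
  funext a
  simp [sndMarginal, placeProb, secondQuestion, h]

open Classical in
theorem sndMarginal_of_gt (N : (Fin 2 → Fin Q) → (Fin 2 → A) → H →L[ℂ] H) {q d : Fin Q}
    (h : d < q) : sndMarginal N q d = coarsen (fun b => b 1) (N ![d, q]) := by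
  funext a
  simp [sndMarginal, placeProb, secondQuestion, h, h.not_gt]

open Classical in
/-- The answers to two distinct positions are marginals of one measurement of the second prover. -/
theorem exists_joint_sndMarginal (N : (Fin 2 → Fin Q) → (Fin 2 → A) → H →L[ℂ] H) {q d : Fin Q}
    (h : q ≠ d) : ∃ p r s, sndMarginal N q d = coarsen (fun b => b r) (N p) ∧
      sndMarginal N d q = coarsen (fun b => b s) (N p) := by
  -- The pair is sent sorted, so it does not reveal which of its entries is real. This is what the
  -- dummy question is for.
  rcases lt_or_gt_of_ne h with h | h
  · exact ⟨![q, d], 0, 1, sndMarginal_of_lt N h, sndMarginal_of_gt N h⟩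
  · exact ⟨![d, q], 1, 0, sndMarginal_of_gt N h, sndMarginal_of_lt N h⟩

variable [CompleteSpace H]

/-- The measurements that read off two positions nearly commute on the state. -/
theorem famNorm_readKraus_commutator_le (hN : ∀ p, IsPOVM (N p)) {E : Fin Q → A → H →L[ℂ] H}
    (hE : ∀ q, IsPOVM (E q)) (hEN : ∀ q a p b, Commute (E q a) (N p b)) {ψ : H} (hψ : ‖ψ‖ = 1)
    {q d : Fin Q} (hqd : q ≠ d) :
    famNorm ((fun p : A × A => G.readKraus N q p.1 (G.readKraus N d p.2 ψ)) -
      fun p => G.readKraus N d p.2 (G.readKraus N q p.1 ψ)) ≤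
    2 * (famNorm ((fun a => G.readKraus N q a ψ) - fun a => CFC.sqrt (E q a) ψ) +
      famNorm ((fun a => G.readKraus N d a ψ) - fun a => CFC.sqrt (E d a) ψ) +
      √(2 * (1 - agreeProb ψ (E q) (sndMarginal N q d))) +
      √(2 * (1 - agreeProb ψ (E d) (sndMarginal N d q)))) := by
  classical
  obtain ⟨p, r, s, h₁, h₂⟩ := exists_joint_sndMarginal N hqd
  have hK : ∀ q, IsKraus (G.readKraus N q) := fun q => (isPOVM_sndAverage G hN q).isKraus
  have hEK : ∀ q a q' b, Commute (CFC.sqrt (E q a)) (G.readKraus N q' b) := fun q a q' b =>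
    commute_sqrt (commute_sqrt (commute_sndAverage G (hEN q a) q' b).symm).symm
  have hEJ : ∀ q a b, Commute (CFC.sqrt (E q a)) (CFC.sqrt (N p b)) := fun q a b =>
    commute_sqrt (commute_sqrt (hEN q a p b).symm).symm
  have h := famNorm_commutator_le (fun b : Fin 2 → A => b r) (fun b => b s) (hK q) (hK d)
    (hE q).isKraus (hE d).isKraus (hN p).isKraus (fun a b => hEK q a d b) (fun a b => hEK d a q b)
    (hEJ q) (hEJ d) ψ
  have h₃ := Real.le_sqrt_of_sq_le
    (famNorm_sqrt_apply_sub_sq_le (fun b : Fin 2 → A => b r) (hE q) (hN p)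
      (fun a b => hEN q a p b) hψ)
  have h₄ := Real.le_sqrt_of_sq_le
    (famNorm_sqrt_apply_sub_sq_le (fun b : Fin 2 → A => b s) (hE d) (hN p)
      (fun a b => hEN d a p b) hψ)
  rw [h₁, h₂]
  linarith

/-- Measurements of the first prover, one for each position, whose disagreement with the second
prover is on average no larger than the losing probability. -/
theorem exists_fst_measurement (G : PCPGame Q A) (hM : ∀ t, IsPOVM (M t)) (hN : ∀ p, IsPOVM (N p))
    (hMN : ∀ t p a b, Commute (M t a) (N p b)) (ψ : H) :
    ∃ E : Fin Q → A → H →L[ℂ] H, (∀ q, IsPOVM (E q)) ∧ (∀ q a p b, Commute (E q a) (N p b)) ∧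
      ∑ q, G.posMass q * (1 - agreeProb ψ (E q) (G.sndAverage N q)) ≤
        1 - G.pureWinProb M N ψ := by
  classical
  let D : (Fin 3 → Fin Q) × Fin 3 → ℝ := fun s =>
    1 - agreeProb ψ (fstMarginal M s.1 s.2) (G.sndAverage N (s.1 s.2))
  have h : ∀ q, ∃ s : (Fin 3 → Fin Q) × Fin 3, s.1 s.2 = q ∧ ∀ s', s'.1 s'.2 = q → D s ≤ D s' := by
    intro q
    -- The best triple and index for `q`; a minimum is at most the average. Triples of probability
    -- zero are allowed, and the constant triple makes the set nonempty.
    obtain ⟨s, hs, hmin⟩ := Finset.exists_min_image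
      (Finset.univ.filter fun s : (Fin 3 → Fin Q) × Fin 3 => s.1 s.2 = q) D
      ⟨(fun _ => q, 0), by simp⟩
    exact ⟨s, by simpa using hs, fun s' hs' => hmin s' (by simpa using hs')⟩
  choose s hs hmin using h
  refine ⟨fun q => fstMarginal M (s q).1 (s q).2, fun q => isPOVM_fstMarginal hM _ _,
    fun q a p b => commute_fstMarginal (fun t a => hMN t p a b) _ _ _, ?_⟩
  rw [sum_posMass_mul]
  have h₁ : ∑ t, G.π t * ∑ j, 1 / 3 * (1 - agreeProb ψ
      (fstMarginal M (s (t j)).1 (s (t j)).2) (G.sndAverage N (t j))) ≤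
      ∑ t, G.π t * ∑ j, 1 / 3 * D (t, j) := by
    refine Finset.sum_le_sum fun t _ => mul_le_mul_of_nonneg_left ?_ (G.π_mem.1 t)
    refine Finset.sum_le_sum fun j _ => mul_le_mul_of_nonneg_left ?_ (by norm_num)
    have := hmin (t j) (t, j) rfl
    simpa only [D, hs] using this
  have h₂ : ∑ t, G.π t * ∑ j, 1 / 3 * D (t, j) = ∑ t, G.π t -
      ∑ t, G.π t * ∑ j, 1 / 3 * agreeProb ψ (fstMarginal M t j) (G.sndAverage N (t j)) := by
    rw [← Finset.sum_sub_distrib]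
    refine Finset.sum_congr rfl fun t _ => ?_
    simp only [Fin.sum_univ_three, D]
    ring
  have h₃ := pureWinProb_le_agree (G := G) hM hN hMN ψ
  rw [h₂, G.π_mem.2] at h₁
  linarith

theorem one_sub_value_le_sqrt (hM : ∀ t, IsPOVM (M t)) (hN : ∀ p, IsPOVM (N p))
    (hMN : ∀ t p a b, Commute (M t a) (N p b)) {ψ : H} (hψ : ‖ψ‖ = 1) :
    0 ≤ 1 - G.pureWinProb M N ψ ∧ 1 - G.value ≤ 4 * (1 - G.pureWinProb M N ψ) +
      6 * (Q * √(224 * (1 - G.pureWinProb M N ψ))) := by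
  obtain ⟨E, hE, hEN, hEagree⟩ := exists_fst_measurement G hM hN hMN ψ
  set ε := 1 - G.pureWinProb M N ψ
  set μ := G.posMass with hμdef
  have hμ : ∀ q, 0 ≤ μ q := G.posMass_mem.1
  have hEF : ∀ q, 0 ≤ 1 - agreeProb ψ (E q) (G.sndAverage N q) := fun q =>
    sub_nonneg.2 (agreeProb_le_one (hE q) (isPOVM_sndAverage G hN q)
      (fun a b => commute_sndAverage G (hEN q a) q b) hψ)
  have hε : 0 ≤ ε := (Finset.sum_nonneg fun q _ => mul_nonneg (hμ q) (hEF q)).trans hEagree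
  refine ⟨hε, ?_⟩
  let e : Fin Q → ℝ := fun q =>
    famNorm ((fun a => G.readKraus N q a ψ) - fun a => CFC.sqrt (E q a) ψ)
  let f : Fin Q → Fin Q → ℝ := fun q d => √(2 * (1 - agreeProb ψ (E q) (sndMarginal N q d)))
  -- Here `d` is measured before `q`. Of the coefficient 4 of `e d`, 2 comes from exchanging K_d for
  -- L_d and back, and 2 from the commutator.
  let h : Fin Q → Fin Q → ℝ := fun q d => 4 * e d + 2 * e q + 2 * f q d + 2 * f d q
  have he : ∀ q, 0 ≤ e q := fun q => famNorm_nonneg _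
  have hf : ∀ q d, 0 ≤ f q d := fun q d => Real.sqrt_nonneg _
  have hh : ∀ q d, 0 ≤ h q d := fun q d => by
    have := he q; have := he d; have := hf q d; have := hf d q
    positivity
  have hdist : ∀ (σ : Equiv.Perm (Fin Q)) m, G.disturbance N σ ψ m ≤
      ∑ i, if i < m then h (σ m) (σ i) else 0 := by
    intro σ m
    refine (famNorm_seqOp_sub_skipOp_le (K := G.readKraus N) (L := fun q a => CFC.sqrt (E q a))
      (fun q => (isPOVM_sndAverage G hN q).isKraus) (fun q => (hE q).isKraus)
      (fun q a q' b => commute_sqrt (commute_sqrt (commute_sndAverage G (hEN q a) q' b).symm).symm)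
      ψ Q σ m).trans (Finset.sum_le_sum fun i _ => ?_)
    split_ifs with him
    · have hc := famNorm_readKraus_commutator_le (G := G) hN hE hEN hψ
        (fun hσ => him.ne (σ.injective hσ).symm : σ m ≠ σ i)
      simp only [h, e, f]
      linarith
    · exact le_rfl
  have he2 : ∑ q, μ q * e q ^ 2 ≤ 2 * ε := by
    refine le_trans ?_ (mul_le_mul_of_nonneg_left hEagree (by norm_num : (0 : ℝ) ≤ 2))
    rw [Finset.mul_sum]
    refine Finset.sum_le_sum fun q _ => ?_
    have := famNorm_sqrt_sub_sqrt_sq_le (hE q) (isPOVM_sndAverage G hN q)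
      (fun a b => commute_sndAverage G (hEN q a) q b) hψ
    refine (mul_le_mul_of_nonneg_left this (hμ q)).trans_eq ?_
    ring
  -- The dummy question is independent of the real one and has the same law μ, so the average over
  -- pairs is exactly the disagreement with the averaged measurement.
  have hf2 : ∑ q, ∑ d, μ q * μ d * f q d ^ 2 ≤ 2 * ε := by
    refine le_trans (le_of_eq ?_)
      (mul_le_mul_of_nonneg_left hEagree (by norm_num : (0 : ℝ) ≤ 2))
    rw [Finset.mul_sum]
    refine Finset.sum_congr rfl fun q _ => ?_
    have h₁ : ∀ d, f q d ^ 2 = 2 * (1 - agreeProb ψ (E q) (sndMarginal N q d)) := fun d =>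
      Real.sq_sqrt (mul_nonneg (by norm_num) (sub_nonneg.2 (agreeProb_le_one (hE q)
        (isPOVM_sndMarginal hN q d) (fun a b => commute_sndMarginal (hEN q a) q d b) hψ)))
    have h₂ : 1 - agreeProb ψ (E q) (G.sndAverage N q) =
        ∑ d, μ d * (1 - agreeProb ψ (E q) (sndMarginal N q d)) := by
      simp only [mul_sub, mul_one, Finset.sum_sub_distrib]
      rw [agreeProb_sndAverage, hμdef, G.posMass_mem.2]
    rw [h₂]
    simp only [h₁, Finset.mul_sum]
    exact Finset.sum_congr rfl fun d _ => by ring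
  have hf2' : ∑ q, ∑ d, μ q * μ d * f d q ^ 2 ≤ 2 * ε := by
    rw [Finset.sum_comm]
    refine le_trans (le_of_eq ?_) hf2
    exact Finset.sum_congr rfl fun d _ => Finset.sum_congr rfl fun q _ => by ring
  have hel : ∑ q, ∑ d, μ q * μ d * e q ^ 2 ≤ 2 * ε := by
    refine le_trans (le_of_eq ?_) he2
    refine Finset.sum_congr rfl fun q _ => ?_
    rw [← Finset.sum_mul, ← Finset.mul_sum, hμdef, G.posMass_mem.2, mul_one]
  have her : ∑ q, ∑ d, μ q * μ d * e d ^ 2 ≤ 2 * ε := by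
    rw [Finset.sum_comm]
    refine le_trans (le_of_eq ?_) hel
    exact Finset.sum_congr rfl fun d _ => Finset.sum_congr rfl fun q _ => by ring
  -- The square of a sum of four terms is at most four times the sum of squares: coefficients 64,
  -- 16, 16, 16, each mean square at most 2ε.
  have hh2 : ∑ q, ∑ d, μ q * μ d * h q d ^ 2 ≤ 224 * ε := by
    have h₁ : ∑ q, ∑ d, μ q * μ d * h q d ^ 2 ≤
        64 * ∑ q, ∑ d, μ q * μ d * e d ^ 2 + 16 * ∑ q, ∑ d, μ q * μ d * e q ^ 2 +
        16 * ∑ q, ∑ d, μ q * μ d * f q d ^ 2 + 16 * ∑ q, ∑ d, μ q * μ d * f d q ^ 2 := by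
      simp only [Finset.mul_sum, ← Finset.sum_add_distrib]
      refine Finset.sum_le_sum fun q _ => Finset.sum_le_sum fun d _ => ?_
      have h₂ : h q d ^ 2 ≤ 64 * e d ^ 2 + 16 * e q ^ 2 + 16 * f q d ^ 2 + 16 * f d q ^ 2 := by
        simp only [h]
        nlinarith [sq_nonneg (4 * e d - 2 * e q), sq_nonneg (4 * e d - 2 * f q d),
          sq_nonneg (4 * e d - 2 * f d q), sq_nonneg (2 * e q - 2 * f q d),
          sq_nonneg (2 * e q - 2 * f d q), sq_nonneg (2 * f q d - 2 * f d q)]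
      refine (mul_le_mul_of_nonneg_left h₂ (mul_nonneg (hμ q) (hμ d))).trans_eq ?_
      ring
    linarith
  let σ : Equiv.Perm (Fin Q) := Tuple.sort fun q => -μ q
  have hσ : Antitone (μ ∘ σ) := fun i j hij => by
    have := Tuple.monotone_sort (fun q => -μ q) hij
    exact neg_le_neg_iff.1 this
  refine (one_sub_value_le (G := G) hM hN hMN hψ σ).trans (add_le_add le_rfl ?_)
  refine mul_le_mul_of_nonneg_left ?_ (by norm_num)
  calc ∑ m, μ (σ m) * G.disturbance N σ ψ m
      ≤ ∑ m, μ (σ m) * ∑ i, (if i < m then h (σ m) (σ i) else 0) :=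
        Finset.sum_le_sum fun m _ => mul_le_mul_of_nonneg_left (hdist σ m) (hμ _)
    _ ≤ Q * √(∑ q, ∑ d, μ q * μ d * h q d ^ 2) := sum_mul_sum_lt_le hμ σ hσ hh
    _ ≤ Q * √(224 * ε) := by gcongr

theorem pureWinProb_le (hM : ∀ t, IsPOVM (M t)) (hN : ∀ p, IsPOVM (N p))
    (hMN : ∀ t p a b, Commute (M t a) (N p b)) {ψ : H} (hψ : ‖ψ‖ = 1) :
    G.pureWinProb M N ψ ≤ 1 - 1 / 10000 * (1 - G.value) ^ 2 / (Q : ℝ) ^ 2 := by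
  obtain ⟨hε, h⟩ := one_sub_value_le_sqrt (G := G) hM hN hMN hψ
  have hQ : (1 : ℝ) ≤ Q := by exact_mod_cast G.pos_of_pcpGame
  have hw₀ := G.value_nonneg
  have hw₁ := G.value_le_one
  set ε := 1 - G.pureWinProb M N ψ with hεdef
  set δ := 1 - G.value
  suffices hs : δ ^ 2 ≤ 10000 * (Q : ℝ) ^ 2 * ε by
    have : 1 / 10000 * δ ^ 2 / (Q : ℝ) ^ 2 ≤ ε := by
      rw [div_le_iff₀ (by positivity)]
      linarith
    linarith
  have hQ2 : (1 : ℝ) ≤ (Q : ℝ) ^ 2 := one_le_pow₀ hQ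
  -- For ε ≥ 1 the bound is trivial; otherwise ε ≤ √ε lets the linear term be absorbed into Q√ε.
  rcases le_total 1 ε with hε1 | hε1
  · have : δ ^ 2 ≤ 1 := pow_le_one₀ (by simp only [δ]; linarith) (by simp only [δ]; linarith)
    nlinarith
  · set s := √ε with hs
    have hs0 : 0 ≤ s := Real.sqrt_nonneg _
    have hs2 : s ^ 2 = ε := Real.sq_sqrt hε
    have hs1 : s ≤ 1 := Real.sqrt_le_one.2 hε1
    -- 224 ≤ 15², and 4 + 6 · 15 = 94 ≤ 100, whose square is 10000.
    have h₁ : √(224 * ε) ≤ 15 * s := by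
      refine Real.sqrt_le_iff.2 ⟨by positivity, ?_⟩
      rw [mul_pow, hs2]
      linarith
    have h₂ : ε ≤ Q * s := by
      rw [← hs2, sq]
      exact mul_le_mul_of_nonneg_right (hs1.trans hQ) hs0
    have h₃ : (Q : ℝ) * √(224 * ε) ≤ Q * (15 * s) := by gcongr
    have h₄ : δ ≤ 100 * (Q * s) := by
      have : 0 ≤ Q * s := by positivity
      linarith
    calc δ ^ 2 ≤ (100 * (Q * s)) ^ 2 := pow_le_pow_left₀ (by simp only [δ]; linarith) h₄ 2
      _ = 10000 * (Q : ℝ) ^ 2 * ε := by rw [← hs2]; ring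

/-- Both sides are homogeneous of degree two in ψ, so ψ can be normalised. This form can be summed
over the unnormalised components of a mixed state. -/
theorem pureWinProb_le_mul_norm_sq (hM : ∀ t, IsPOVM (M t)) (hN : ∀ p, IsPOVM (N p))
    (hMN : ∀ t p a b, Commute (M t a) (N p b)) (ψ : H) :
    G.pureWinProb M N ψ ≤ (1 - 1 / 10000 * (1 - G.value) ^ 2 / (Q : ℝ) ^ 2) * ‖ψ‖ ^ 2 := by
  have hsmul : ∀ (c : ℝ) (φ : H),
      G.pureWinProb M N ((c : ℂ) • φ) = c ^ 2 * G.pureWinProb M N φ := by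
    intro c φ
    have : ∀ t p a b, (inner ℂ ((c : ℂ) • φ) (M t a (N p b ((c : ℂ) • φ)))).re =
        c ^ 2 * (inner ℂ φ (M t a (N p b φ))).re := by
      intro t p a b
      rw [map_smul, map_smul, inner_smul_left, inner_smul_right, Complex.conj_ofReal,
        Complex.re_ofReal_mul, Complex.re_ofReal_mul]
      ring
    simp only [pureWinProb, TwoProverGame.winProb, this, Finset.mul_sum]
    refine Finset.sum_congr rfl fun t _ => Finset.sum_congr rfl fun p _ =>
      Finset.sum_congr rfl fun s _ => Finset.sum_congr rfl fun a _ =>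
        Finset.sum_congr rfl fun b _ => by ring
  rcases eq_or_ne ψ 0 with rfl | hψ
  · have h0 : G.pureWinProb M N 0 = 0 := by simpa using hsmul 0 0
    simp [h0]
  · have hn : ‖ψ‖ ≠ 0 := norm_ne_zero_iff.2 hψ
    have h1 : ‖((‖ψ‖⁻¹ : ℝ) : ℂ) • ψ‖ = 1 := by
      rw [norm_smul, Complex.norm_real, norm_inv, norm_norm, inv_mul_cancel₀ hn]
    have h2 : ψ = ((‖ψ‖ : ℝ) : ℂ) • (((‖ψ‖⁻¹ : ℝ) : ℂ) • ψ) := by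
      rw [smul_smul, ← Complex.ofReal_mul, mul_inv_cancel₀ hn, Complex.ofReal_one, one_smul]
    have h3 := hsmul ‖ψ‖ (((‖ψ‖⁻¹ : ℝ) : ℂ) • ψ)
    rw [← h2] at h3
    rw [h3, mul_comm]
    exact mul_le_mul_of_nonneg_right (pureWinProb_le (G := G) hM hN hMN h1) (sq_nonneg _)

end PCPGame

/-! ### Mixed states and conclusion. -/

theorem PCPGame.comValue_le {Q : ℕ} {A : Type u} [Fintype A] (G : PCPGame Q A) :
    TwoProverGame.comValue.{v} G.dummyOracularization ≤
      1 - 1 / 10000 * (1 - G.value) ^ 2 / (Q : ℝ) ^ 2 := by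
  have hQ : (1 : ℝ) ≤ Q := by exact_mod_cast G.pos_of_pcpGame
  have hw₀ := G.value_nonneg
  have hw₁ := G.value_le_one
  refine Real.sSup_le ?_ ?_
  · rintro _ ⟨θ, ⟨H, _, _, _, ψ, M, N, hψ, hM, hN, hMN, hθ⟩, rfl⟩
    have h₁ : HasSum (fun k => G.pureWinProb M N (ψ k)) (G.dummyOracularization.winProb θ) :=
      TwoProverGame.winProb_hasSum _ fun t p a b => by
        simpa using Complex.hasSum_re (hθ t p a b)
    have h₂ := hψ.mul_left (1 - 1 / 10000 * (1 - G.value) ^ 2 / (Q : ℝ) ^ 2)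
    rw [mul_one] at h₂
    exact hasSum_le (fun k => PCPGame.pureWinProb_le_mul_norm_sq hM hN (fun t p a b => hMN t p a b) (ψ k))
      h₁ h₂
  · have h₁ : (1 - G.value) ^ 2 ≤ 1 := pow_le_one₀ (by linarith) (by linarith)
    have h₂ : (1 : ℝ) ≤ (Q : ℝ) ^ 2 := one_le_pow₀ hQ
    rw [sub_nonneg, div_le_one (by positivity)]
    linarith

theorem lemma4p1 :
    ∃ c : ℝ, 0 < c ∧
      ∀ (Q : ℕ) (A : Type u) [Fintype A] [Nonempty A] (G : PCPGame Q A),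
        G.value ≤ TwoProverGame.unentValue.{w} G.dummyOracularization ∧
        TwoProverGame.unentValue.{w} G.dummyOracularization ≤ 1 - (1 - G.value) / 3 ∧
        TwoProverGame.comValue.{v} G.dummyOracularization
          ≤ 1 - c * (1 - G.value) ^ 2 / (Q : ℝ) ^ 2 :=
  ⟨1 / 10000, by norm_num, fun _ _ _ _ G =>
    ⟨G.value_le_unentValue, G.unentValue_le, G.comValue_le⟩⟩
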